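/- **Databases.** Names and data values are strings over an infinite alphabet of letters; the data values form the countably infinite domain $D$, and $\mathtt{NULL}\notin D$. A schema $\mathbf R$ is a finite set of relation names, each with a nonempty finite set $att(R)$ of attributes; an instance $I$ assigns to each $R\in\mathbf R$ a finite set $R^I$ of tuples $t:att(R)\to D\cup\{\mathtt{NULL}\}$. A key $R[A_1,\dots,A_m]$ ($m\ge1$, distinct attributes of $R$) holds in $I$ if no tuple of $R^I$ is $\mathtt{NULL}$ in some $A_k$ and distinct tuples of $R^I$ differ in some $A_k$. A foreign key $R[A_1,\dots,A_m]\subseteq_{FK}S[B_1,\dots,B_m]$ ($m\ge 1$, distinct $A$'s, distinct $B$'s) holds in $I$ if the key $S[B_1,\dots,B_m]$ holds in $I$ and each $t\in R^I$ has some $t.A_k=\mathtt{NULL}$ or agrees with some $s\in S^I$ ($t.A_k=s.B_k$ for all $k$). A set $\Sigma$ of PKs and FKs over $\mathbf R$ is a finite set of keys and foreign keys with at most one key per relation name; $I\models\Sigma$ means that all of them hold. **Graphs and queries.** An RDF graph is a finite set of triples over IRIs, blank nodes and literals (the literals are the elements of $D$); it is consistent if it has a model under the direct (description logic) semantics of OWL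 2 without datatypes. Relational algebra is the algebra with $R$, $\mathtt{NULL}_A$, $\sigma_{A=a}$, $\sigma_{A\ne a}$, $\sigma_{IsNull(A)}$, $\sigma_{IsNotNull(A)}$, $\pi$, $\delta_{A\to B}$, $\bowtie$ (shared attributes must be equal and non-null), $\cup$, $\smallsetminus$. SPARQL is the language of non-parametric graph patterns built from $\{\,\}$ and triple patterns with AND, OPT, UNION, MINUS, FILTER (Boolean combinations of $bound(?X)$, $?X=c$ with $c$ an IRI, $?X=?Y$) and nested SELECT with AS, under set semantics, where $\{\,\}$ has no answer over the empty graph. (Non-parametric: a variable of the body of a SELECT subpattern that the SELECT clause does not select does not occur outside that subpattern.) For a tuple $t$, $tr(t)$ is the mapping $?A\mapsto t.A$ defined for the attributes $A$ with $t.A\ne\mathtt{NULL}$. **The mapping.** Fix a base IRI, an IRI $a$, and identifiers of tuples. Let "$\#$", "$,$", "$=$" be separators that occur neither in names nor in data values; the IRIs generated below are not in the RDF/RDFS/OWL vocabulary. $R$ is a *binary relation* (between $S$ and $T$) if it has exactly two attributes $A,B$, its primary key in $\Sigma$ is $R[A,B]$, $\Sigma$ contains $R[A]\subseteq_{FK}S[C]$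 and $R[B]\subseteq_{FK}T[D]$ with $S,T\ne R$ and no other foreign key $R[A]\subseteq_{FK}\cdot$ or $R[B]\subseteq_{FK}\cdot$, no foreign key from the pair $A,B$ (in either order), and no one- or two-attribute foreign key into $R$. Every other relation of $\mathbf R$ is a *class*. The graph $\mathcal{DM}(\mathbf R,\Sigma,I)$ consists of: * for each class $R$: its IRI $base\,R$, typed owl:Class; for each attribute $A$ of it the IRI $base\,R\#A$, typed owl:DatatypeProperty, with rdfs:domain $base\,R$; * for each foreign key $R[\bar A]\subseteq_{FK}T[\bar B]$ of a class $R$: the IRI $base\,R,T\#\bar A,\bar B$, typed owl:ObjectProperty, with domain and range the IRIs of $R$ and $T$ (where these are classes); for each binary relation as above: the IRI $base\,R\#A,B,C,D$, typed owl:ObjectProperty, with domain and range the IRIs of $S$ and $T$; * each tuple $t$ of a class $R$ is represented by the IRI $base\,R\#A_1{=}t.A_1,\dots,A_n{=}t.A_n$ if $R[A_1,\dots,A_n]$ is a key in $\Sigma$ and these values are not $\mathtt{NULL}$, and by a blank node labelled by $R$ and the identifier of $t$ (distinct tuples have distinct labels) if $\Sigma$ has no key of $R$. This node is typed by the IRI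 of $R$ and has, for each $A$ with $t.A\neq\mathtt{NULL}$, the triple with predicate $base\,R\#A$ and object $t.A$; * for each foreign key of a class as above, and tuples $t_1$ of $R$, $t_2$ of $T$ with $t_1.A_k=t_2.B_k$ for all $k$, the triple linking their nodes by the IRI of the foreign key; for each tuple $t$ of a binary relation as above, and tuples $t_1$ of $S$, $t_2$ of $T$ with $t.A=t_1.C$, $t.B=t_2.D$, the triple linking the nodes of $t_1$ and $t_2$ by the IRI of the binary relation. $\mathcal{DM}_{pk+fk}(\mathbf R,\Sigma,I)$ is $\mathcal{DM}(\mathbf R,\Sigma,I)$ together with the triple $(a,\text{owl:differentFrom},a)$ whenever one of the following violations is found: (i) two distinct tuples agree on a primary key in $\Sigma$, or a primary key attribute is $\mathtt{NULL}$; (ii) for a foreign key $R[\bar A]\subseteq_{FK}S[\bar B]$ in $\Sigma$, some tuple of $R^I$ is non-null on $\bar A$ and no tuple of $S^I$ has these values in $\bar B$; (iii) for such a foreign key, two distinct tuples of $S^I$ agree on $\bar B$, or some tuple of $S^I$ is $\mathtt{NULL}$ in an attribute of $\bar B$. **Theorem.** For every base IRI, every choice of tuple identifiers and every IRI $a$ that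 is not in the RDF/RDFS/OWL vocabulary, $\mathcal{DM}_{pk+fk}$ is not monotone, and it is 1. *information preserving*: there is a computable map $\mathcal N$ from RDF graphs to relational instances (with their schemas) such that $\mathcal N(\mathcal{DM}_{pk+fk}(\mathbf R,\Sigma,I))=I$ for all $\mathbf R$, $\Sigma$ and all $I\models\Sigma$; 2. *query preserving*: for every nonempty schema $\mathbf R$, every $\Sigma$ and every relational algebra query $Q$ over $\mathbf R$ there is a SPARQL query $Q^\star$ such that $tr(\llbracket Q\rrbracket_I)=\llbracket Q^\star\rrbracket_{\mathcal{DM}_{pk+fk}(\mathbf R,\Sigma,I)}$ for all $I\models\Sigma$; 3. *semantics preserving*: for all $\mathbf R$, $\Sigma$ and $I$, $I\models\Sigma$ if and only if $\mathcal{DM}_{pk+fk}(\mathbf R,\Sigma,I)$ is consistent. -/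

import Mathlib

namespace DirMap

open Classical

noncomputable section

/-! ## Strings, IRIs, RDF graphs -/

/-- Strings over a fixed infinite alphabet of letters: relation and attribute names. -/
abbrev Name := List ℕ

/-- The countably infinite domain `D` of data values: strings over the same alphabet. -/
abbrev Val := List ℕ

/-- SPARQL variables; the variable `?A` attached to the attribute `A` is `A` itself, read as
a variable. -/
abbrev Var := Name

/-- The reserved separator symbols (number sign, comma, equality sign) used to build IRIs.
They are not letters, so they occur neither in names nor in data values. -/
inductive Sep
  | hash
  | comma
  | eq
  deriving DecidableEq

abbrev Sym := ℕ ⊕ Sep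

/-- Strings over letters and separators. -/
abbrev Word := List Sym

/-- A string of letters as a word. -/
def emb (w : List ℕ) : Word := w.map Sum.inl

abbrev hash : Word := [Sum.inr Sep.hash]
abbrev comma : Word := [Sum.inr Sep.comma]
abbrev eqSign : Word := [Sum.inr Sep.eq]

/-- The reserved RDF, RDFS and OWL vocabulary. -/
inductive Vocab
  | rdfType
  | rdfsDomain
  | rdfsRange
  | rdfsSubClassOf
  | rdfsSubPropertyOf
  | owlClass
  | owlObjectProperty
  | owlDatatypeProperty
  | owlThing
  | owlNothing
  | owlTopObjectProperty
  | owlBottomObjectProperty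
  | owlTopDataProperty
  | owlBottomDataProperty
  | owlSameAs
  | owlDifferentFrom
  | owlEquivalentClass
  | owlDisjointWith
  | owlComplementOf
  | owlEquivalentProperty
  | owlPropertyDisjointWith
  | owlInverseOf
  | owlFunctionalProperty
  | owlInverseFunctionalProperty
  | owlReflexiveProperty
  | owlIrreflexiveProperty
  | owlSymmetricProperty
  | owlAsymmetricProperty
  | owlTransitiveProperty
  deriving DecidableEq

instance : Fintype Sep :=
  Fintype.ofList [.hash, .comma, .eq] (by intro x; cases x <;> simp)

instance : Fintype Vocab :=
  Fintype.ofList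
    [.rdfType, .rdfsDomain, .rdfsRange, .rdfsSubClassOf, .rdfsSubPropertyOf, .owlClass,
      .owlObjectProperty, .owlDatatypeProperty, .owlThing, .owlNothing, .owlTopObjectProperty,
      .owlBottomObjectProperty, .owlTopDataProperty, .owlBottomDataProperty, .owlSameAs,
      .owlDifferentFrom, .owlEquivalentClass, .owlDisjointWith, .owlComplementOf,
      .owlEquivalentProperty, .owlPropertyDisjointWith, .owlInverseOf, .owlFunctionalProperty,
      .owlInverseFunctionalProperty, .owlReflexiveProperty, .owlIrreflexiveProperty,
      .owlSymmetricProperty, .owlAsymmetricProperty, .owlTransitiveProperty]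
    (by intro x; cases x <;> simp)

instance : Primcodable Sep :=
  Primcodable.ofEquiv (Fin (Fintype.card Sep)) (Fintype.equivFin Sep)

instance : Primcodable Vocab :=
  Primcodable.ofEquiv (Fin (Fintype.card Vocab)) (Fintype.equivFin Vocab)

/-- IRIs: the reserved ones and all the others (words). -/
abbrev IRI := Vocab ⊕ Word

/-- A reserved IRI. -/
abbrev IRI.voc (v : Vocab) : IRI := Sum.inl v

/-- A non-reserved IRI. -/
abbrev IRI.res (w : Word) : IRI := Sum.inr w

/-- IRIs and blank nodes (disjoint). -/
abbrev Node := IRI ⊕ Word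

abbrev Node.iri (u : IRI) : Node := Sum.inl u
abbrev Node.blank (w : Word) : Node := Sum.inr w

/-- RDF terms: IRIs, blank nodes and literals (pairwise disjoint). Data values are the literals. -/
abbrev Term := Node ⊕ Val

abbrev Term.node (x : Node) : Term := Sum.inl x
abbrev Term.lit (v : Val) : Term := Sum.inr v
abbrev Term.iri (u : IRI) : Term := Sum.inl (Sum.inl u)

/-- RDF triples: subject, predicate, object. -/
abbrev Triple := Node × IRI × Term

abbrev Graph := Finset Triple

/-! ## Relational databases -/

@[ext]
structure Schema where
  rels : Finset Name
  att : Name → Finset Name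
  att_nonempty : ∀ R ∈ rels, (att R).Nonempty
  /-- normalisation: `att` carries no information outside the schema -/
  att_out : ∀ R, R ∉ rels → att R = ∅

/-- Tuples, with `none` for NULL. A tuple over a finite set `U` of attributes is represented by
the function that extends it by `none` outside `U`. -/
abbrev Tuple := Name → Option Val

@[ext]
structure DBInstance (S : Schema) where
  rows : Name → Set Tuple
  finite : ∀ R, (rows R).Finite
  supp : ∀ R, ∀ t ∈ rows R, ∀ A, A ∉ S.att R → t A = none
  rows_out : ∀ R, R ∉ S.rels → rows R = ∅

/-- Relational instances together with the schema that they are instances of. -/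
abbrev DB := Σ S : Schema, DBInstance S

/-- Keys `R[A₁, …, Aₘ]` and foreign keys `R[A₁, …, Aₘ] ⊆ S[B₁, …, Bₘ]`. -/
inductive Constraint
  | key (R : Name) (as : List Name)
  | fk (R : Name) (as : List Name) (S : Name) (bs : List Name)

/-- `c` is a key or a foreign key over the schema `S`. -/
def Constraint.WF (S : Schema) : Constraint → Prop
  | .key R as => R ∈ S.rels ∧ as ≠ [] ∧ as.Nodup ∧ ∀ A ∈ as, A ∈ S.att R
  | .fk R as T bs =>
      R ∈ S.rels ∧ as ≠ [] ∧ as.Nodup ∧ (∀ A ∈ as, A ∈ S.att R) ∧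
      T ∈ S.rels ∧ bs.Nodup ∧ (∀ B ∈ bs, B ∈ S.att T) ∧ as.length = bs.length

/-- Sets of primary keys and foreign keys over `S`. -/
structure ConstraintSet (S : Schema) where
  cs : Finset Constraint
  wf : ∀ c ∈ cs, c.WF S
  key_unique : ∀ R as bs, Constraint.key R as ∈ cs → Constraint.key R bs ∈ cs → as = bs

def DBInstance.SatKey {S : Schema} (I : DBInstance S) (R : Name) (as : List Name) : Prop :=
  (∀ t ∈ I.rows R, ∀ A ∈ as, t A ≠ none) ∧
  (∀ t₁ ∈ I.rows R, ∀ t₂ ∈ I.rows R, (∀ A ∈ as, t₁ A = t₂ A) → t₁ = t₂)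

def DBInstance.Sat {S : Schema} (I : DBInstance S) : Constraint → Prop
  | .key R as => I.SatKey R as
  | .fk R as T bs => I.SatKey T bs ∧
      ∀ t ∈ I.rows R, (∃ A ∈ as, t A = none) ∨ ∃ s ∈ I.rows T, as.map t = bs.map s

/-- `I ⊨ Σ`. -/
def DBInstance.Models {S : Schema} (I : DBInstance S) (K : ConstraintSet S) : Prop :=
  ∀ c ∈ K.cs, I.Sat c

/-! ## Relational algebra with nulls -/

inductive RAExpr
  | rel (R : Name)
  | null (A : Name)
  | selEq (A : Name) (a : Val) (e : RAExpr)
  | selNe (A : Name) (a : Val) (e : RAExpr)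
  | selNull (A : Name) (e : RAExpr)
  | selNotNull (A : Name) (e : RAExpr)
  | proj (U : Finset Name) (e : RAExpr)
  | rename (A B : Name) (e : RAExpr)
  | join (e₁ e₂ : RAExpr)
  | union (e₁ e₂ : RAExpr)
  | diff (e₁ e₂ : RAExpr)

def RAExpr.att (S : Schema) : RAExpr → Finset Name
  | .rel R => S.att R
  | .null A => {A}
  | .selEq _ _ e => e.att S
  | .selNe _ _ e => e.att S
  | .selNull _ e => e.att S
  | .selNotNull _ e => e.att S
  | .proj U _ => U
  | .rename A B e => (e.att S \ {A}) ∪ {B}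
  | .join e₁ e₂ => e₁.att S ∪ e₂.att S
  | .union e₁ _ => e₁.att S
  | .diff e₁ _ => e₁.att S

/-- `φ` is a relational algebra expression over the schema `S`. -/
def RAExpr.WF (S : Schema) : RAExpr → Prop
  | .rel R => R ∈ S.rels
  | .null _ => True
  | .selEq A _ e => e.WF S ∧ A ∈ e.att S
  | .selNe A _ e => e.WF S ∧ A ∈ e.att S
  | .selNull A e => e.WF S ∧ A ∈ e.att S
  | .selNotNull A e => e.WF S ∧ A ∈ e.att S
  | .proj U e => e.WF S ∧ U ⊆ e.att S
  | .rename A B e => e.WF S ∧ A ∈ e.att S ∧ B ∉ e.att S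
  | .join e₁ e₂ => e₁.WF S ∧ e₂.WF S
  | .union e₁ e₂ => e₁.WF S ∧ e₂.WF S ∧ e₁.att S = e₂.att S
  | .diff e₁ e₂ => e₁.WF S ∧ e₂.WF S ∧ e₁.att S = e₂.att S

/-- The evaluation of a relational algebra expression over an instance. In each clause the value
outside the attributes of the expression is `none` (the representation of tuples). -/
def RAExpr.eval {S : Schema} (I : DBInstance S) : RAExpr → Set Tuple
  | .rel R => I.rows R
  | .null _ => {fun _ => none}
  | .selEq A a e => {t ∈ e.eval I | t A = some a}
  | .selNe A a e => {t ∈ e.eval I | t A ≠ none ∧ t A ≠ some a}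
  | .selNull A e => {t ∈ e.eval I | t A = none}
  | .selNotNull A e => {t ∈ e.eval I | t A ≠ none}
  | .proj U e => {t | ∃ t' ∈ e.eval I, (∀ A ∈ U, t A = t' A) ∧ ∀ A, A ∉ U → t A = none}
  | .rename A B e => {t | ∃ t' ∈ e.eval I, t B = t' A ∧
      (∀ C ∈ e.att S \ {A}, t C = t' C) ∧
      ∀ C, C ∉ (e.att S \ {A}) ∪ {B} → t C = none}
  | .join e₁ e₂ => {t | ∃ t₁ ∈ e₁.eval I, ∃ t₂ ∈ e₂.eval I,
      (∀ A ∈ e₁.att S ∩ e₂.att S, t A = t₁ A ∧ t A = t₂ A ∧ t A ≠ none) ∧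
      (∀ A ∈ e₁.att S \ e₂.att S, t A = t₁ A) ∧
      (∀ A ∈ e₂.att S \ e₁.att S, t A = t₂ A) ∧
      ∀ A, A ∉ e₁.att S ∪ e₂.att S → t A = none}
  | .union e₁ e₂ => e₁.eval I ∪ e₂.eval I
  | .diff e₁ e₂ => e₁.eval I \ e₂.eval I

/-! ## SPARQL -/

/-- Subject or object position of a triple pattern. -/
inductive TermPat
  | iri (u : IRI)
  | lit (v : Val)
  | var (x : Var)

/-- Predicate position of a triple pattern. -/
inductive PredPat
  | iri (u : IRI)
  | var (x : Var)

/-- Built-in conditions. -/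
inductive Cond
  | bound (x : Var)
  | eqConst (x : Var) (c : IRI)
  | eqVar (x y : Var)
  | not (r : Cond)
  | or (r₁ r₂ : Cond)
  | and (r₁ r₂ : Cond)

/-- Graph patterns; `select [(A₁, B₁), …, (Aₘ, Bₘ)] [C₁, …, Cₙ] P` is
`(SELECT {?A₁ AS ?B₁, …, ?Aₘ AS ?Bₘ, ?C₁, …, ?Cₙ} P)`. -/
inductive Pattern
  | empty
  | triple (s : TermPat) (p : PredPat) (o : TermPat)
  | and (P₁ P₂ : Pattern)
  | opt (P₁ P₂ : Pattern)
  | union (P₁ P₂ : Pattern)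
  | minus (P₁ P₂ : Pattern)
  | filter (P : Pattern) (r : Cond)
  | select (ren : List (Var × Var)) (keep : List Var) (P : Pattern)

def TermPat.vars : TermPat → Set Var
  | .iri _ => ∅
  | .lit _ => ∅
  | .var x => {x}

def PredPat.vars : PredPat → Set Var
  | .iri _ => ∅
  | .var x => {x}

def Cond.vars : Cond → Set Var
  | .bound x => {x}
  | .eqConst x _ => {x}
  | .eqVar x y => {x, y}
  | .not r => r.vars
  | .or r₁ r₂ => r₁.vars ∪ r₂.vars
  | .and r₁ r₂ => r₁.vars ∪ r₂.vars

/-- The variables listed in a SELECT clause. -/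
def selectVars (ren : List (Var × Var)) (keep : List Var) : Set Var :=
  {x | x ∈ ren.map Prod.fst ∨ x ∈ ren.map Prod.snd ∨ x ∈ keep}

/-- The variables occurring in a pattern. -/
def Pattern.vars : Pattern → Set Var
  | .empty => ∅
  | .triple s p o => s.vars ∪ p.vars ∪ o.vars
  | .and P₁ P₂ => P₁.vars ∪ P₂.vars
  | .opt P₁ P₂ => P₁.vars ∪ P₂.vars
  | .union P₁ P₂ => P₁.vars ∪ P₂.vars
  | .minus P₁ P₂ => P₁.vars ∪ P₂.vars
  | .filter P r => P.vars ∪ r.vars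
  | .select ren keep P => selectVars ren keep ∪ P.vars

/-- The syntactic condition on SELECT clauses. -/
def Pattern.WF : Pattern → Prop
  | .empty => True
  | .triple _ _ _ => True
  | .and P₁ P₂ => P₁.WF ∧ P₂.WF
  | .opt P₁ P₂ => P₁.WF ∧ P₂.WF
  | .union P₁ P₂ => P₁.WF ∧ P₂.WF
  | .minus P₁ P₂ => P₁.WF ∧ P₂.WF
  | .filter P _ => P.WF
  | .select ren keep P => P.WF ∧
      (ren.map Prod.fst ++ ren.map Prod.snd ++ keep).Nodup ∧
      ∀ b ∈ ren.map Prod.snd, b ∉ P.vars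

/-- No variable that is projected out by a SELECT inside the pattern occurs outside of that
SELECT subpattern; `X` is the set of variables occurring around the pattern. -/
def Pattern.NonParamIn (X : Set Var) : Pattern → Prop
  | .empty => True
  | .triple _ _ _ => True
  | .and P₁ P₂ => P₁.NonParamIn (X ∪ P₂.vars) ∧ P₂.NonParamIn (X ∪ P₁.vars)
  | .opt P₁ P₂ => P₁.NonParamIn (X ∪ P₂.vars) ∧ P₂.NonParamIn (X ∪ P₁.vars)
  | .union P₁ P₂ => P₁.NonParamIn (X ∪ P₂.vars) ∧ P₂.NonParamIn (X ∪ P₁.vars)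
  | .minus P₁ P₂ => P₁.NonParamIn (X ∪ P₂.vars) ∧ P₂.NonParamIn (X ∪ P₁.vars)
  | .filter P r => P.NonParamIn (X ∪ r.vars)
  | .select ren keep P =>
      (∀ x ∈ P.vars, x ∉ ren.map Prod.fst → x ∉ keep → x ∉ X) ∧
      P.NonParamIn (X ∪ selectVars ren keep)

def Pattern.NonParametric (P : Pattern) : Prop := P.NonParamIn ∅

/-- Mappings: partial functions from variables to RDF terms. -/
abbrev Mapping := Var → Option Term

def Mapping.dom (μ : Mapping) : Set Var := {x | μ x ≠ none}

def Mapping.Compat (μ₁ μ₂ : Mapping) : Prop := ∀ x ∈ μ₁.dom ∩ μ₂.dom, μ₁ x = μ₂ x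

/-- Union of mappings (used for compatible ones). -/
def Mapping.union (μ₁ μ₂ : Mapping) : Mapping := fun x => if μ₁ x = none then μ₂ x else μ₁ x

def Mapping.restrict (μ : Mapping) (W : List Var) : Mapping :=
  fun x => if x ∈ W then μ x else none

/-- The renaming of a mapping along pairs `A → B` (used for lists without repetitions and
mappings undefined at the `B`s). -/
def Mapping.rename (ren : List (Var × Var)) (μ : Mapping) : Mapping := fun x =>
  match ren.find? (fun ab => ab.2 = x) with
  | some ab => μ ab.1
  | none => if x ∈ ren.map Prod.fst then none else μ x

def TermPat.app (μ : Mapping) : TermPat → Option Term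
  | .iri u => some (Term.iri u)
  | .lit v => some (Term.lit v)
  | .var x => μ x

def PredPat.app (μ : Mapping) : PredPat → Option Term
  | .iri u => some (Term.iri u)
  | .var x => μ x

/-- Satisfaction of a built-in condition by a mapping. -/
def Cond.Holds (μ : Mapping) : Cond → Prop
  | .bound x => x ∈ μ.dom
  | .eqConst x c => μ x = some (Term.iri c)
  | .eqVar x y => x ∈ μ.dom ∧ y ∈ μ.dom ∧ μ x = μ y
  | .not r => ¬ r.Holds μ
  | .or r₁ r₂ => r₁.Holds μ ∨ r₂.Holds μ
  | .and r₁ r₂ => r₁.Holds μ ∧ r₂.Holds μ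

/-- The evaluation of a graph pattern over an RDF graph. -/
def Pattern.eval (G : Graph) : Pattern → Set Mapping
  | .empty => {μ | G.Nonempty ∧ μ = fun _ => none}
  | .triple s p o => {μ | μ.dom = s.vars ∪ p.vars ∪ o.vars ∧
      ∃ g ∈ G, s.app μ = some (Term.node g.1) ∧ p.app μ = some (Term.iri g.2.1) ∧
        o.app μ = some g.2.2}
  | .and P₁ P₂ => {μ | ∃ μ₁ ∈ P₁.eval G, ∃ μ₂ ∈ P₂.eval G, μ₁.Compat μ₂ ∧ μ = μ₁.union μ₂}
  | .opt P₁ P₂ =>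
      {μ | ∃ μ₁ ∈ P₁.eval G, ∃ μ₂ ∈ P₂.eval G, μ₁.Compat μ₂ ∧ μ = μ₁.union μ₂} ∪
      {μ ∈ P₁.eval G | ∀ μ' ∈ P₂.eval G, ¬ μ.Compat μ'}
  | .union P₁ P₂ => P₁.eval G ∪ P₂.eval G
  | .minus P₁ P₂ =>
      {μ ∈ P₁.eval G | ∀ μ' ∈ P₂.eval G, ¬ μ.Compat μ' ∨ μ.dom ∩ μ'.dom = ∅}
  | .filter P r => {μ ∈ P.eval G | r.Holds μ}
  | .select ren keep P =>
      {μ | ∃ μ' ∈ P.eval G, μ = (μ'.restrict (ren.map Prod.fst ++ keep)).rename ren}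

/-- The mapping `tr(t)` of a tuple: `?A ↦ t.A` for the attributes `A` with `t.A` not null. -/
def tr (t : Tuple) : Mapping := fun x => (t x).map Term.lit

/-! ## Consistency under OWL semantics

Model-theoretic (direct) semantics of OWL 2 without datatypes, for the axioms between named
entities: each triple is read as the axiom or assertion that it encodes. Declaration triples say
whether a property is an object property or a data property; IRIs and blank nodes denote named
and anonymous individuals. -/

structure OWLInterp where
  Dom : Type
  Data : Type
  cls : IRI → Set Dom
  op : IRI → Dom → Dom → Prop
  dp : IRI → Dom → Data → Prop
  ind : Node → Dom
  lit : Val → Data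
  lit_inj : Function.Injective lit
  thing : cls (IRI.voc .owlThing) = Set.univ
  nothing : cls (IRI.voc .owlNothing) = ∅
  topOP : ∀ x y, op (IRI.voc .owlTopObjectProperty) x y
  bottomOP : ∀ x y, ¬ op (IRI.voc .owlBottomObjectProperty) x y
  topDP : ∀ x y, dp (IRI.voc .owlTopDataProperty) x y
  bottomDP : ∀ x y, ¬ dp (IRI.voc .owlBottomDataProperty) x y

/-- `G` contains the triple `(x, v, y)`, where `x`, `y` are IRIs and `v` is reserved. -/
def Graph.Has (G : Graph) (x : IRI) (v : Vocab) (y : IRI) : Prop :=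
  (Node.iri x, IRI.voc v, Term.iri y) ∈ G

def IRI.IsClassName (u : IRI) : Prop :=
  (∃ w, u = IRI.res w) ∨ u = IRI.voc .owlThing ∨ u = IRI.voc .owlNothing

def Graph.IsObjProp (G : Graph) (p : IRI) : Prop :=
  G.Has p .rdfType (IRI.voc .owlObjectProperty) ∨
  p = IRI.voc .owlTopObjectProperty ∨ p = IRI.voc .owlBottomObjectProperty

def Graph.IsDataProp (G : Graph) (p : IRI) : Prop :=
  G.Has p .rdfType (IRI.voc .owlDatatypeProperty) ∨
  p = IRI.voc .owlTopDataProperty ∨ p = IRI.voc .owlBottomDataProperty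

structure OWLInterp.IsModel (M : OWLInterp) (G : Graph) : Prop where
  classAssertion : ∀ x c, c.IsClassName → (x, IRI.voc .rdfType, Term.iri c) ∈ G →
    M.ind x ∈ M.cls c
  objectAssertion : ∀ x p y, G.IsObjProp p → (x, p, Term.node y) ∈ G →
    M.op p (M.ind x) (M.ind y)
  dataAssertion : ∀ x p v, G.IsDataProp p → (x, p, Term.lit v) ∈ G →
    M.dp p (M.ind x) (M.lit v)
  sameAs : ∀ x y, (x, IRI.voc .owlSameAs, Term.node y) ∈ G → M.ind x = M.ind y
  differentFrom : ∀ x y, (x, IRI.voc .owlDifferentFrom, Term.node y) ∈ G → M.ind x ≠ M.ind y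
  subClassOf : ∀ c d, G.Has c .rdfsSubClassOf d → M.cls c ⊆ M.cls d
  equivalentClass : ∀ c d, G.Has c .owlEquivalentClass d → M.cls c = M.cls d
  disjointWith : ∀ c d, G.Has c .owlDisjointWith d → M.cls c ∩ M.cls d = ∅
  complementOf : ∀ c d, G.Has c .owlComplementOf d → M.cls c = (M.cls d)ᶜ
  objectDomain : ∀ p c, G.IsObjProp p → G.Has p .rdfsDomain c → ∀ x y, M.op p x y → x ∈ M.cls c
  objectRange : ∀ p c, G.IsObjProp p → G.Has p .rdfsRange c → ∀ x y, M.op p x y → y ∈ M.cls c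
  dataDomain : ∀ p c, G.IsDataProp p → G.Has p .rdfsDomain c → ∀ x v, M.dp p x v → x ∈ M.cls c
  subObjectProperty : ∀ p q, G.IsObjProp p → G.IsObjProp q → G.Has p .rdfsSubPropertyOf q →
    ∀ x y, M.op p x y → M.op q x y
  subDataProperty : ∀ p q, G.IsDataProp p → G.IsDataProp q → G.Has p .rdfsSubPropertyOf q →
    ∀ x v, M.dp p x v → M.dp q x v
  equivalentObjectProperty : ∀ p q, G.IsObjProp p → G.IsObjProp q →
    G.Has p .owlEquivalentProperty q → ∀ x y, M.op p x y ↔ M.op q x y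
  equivalentDataProperty : ∀ p q, G.IsDataProp p → G.IsDataProp q →
    G.Has p .owlEquivalentProperty q → ∀ x v, M.dp p x v ↔ M.dp q x v
  disjointObjectProperty : ∀ p q, G.IsObjProp p → G.IsObjProp q →
    G.Has p .owlPropertyDisjointWith q → ∀ x y, ¬ (M.op p x y ∧ M.op q x y)
  disjointDataProperty : ∀ p q, G.IsDataProp p → G.IsDataProp q →
    G.Has p .owlPropertyDisjointWith q → ∀ x v, ¬ (M.dp p x v ∧ M.dp q x v)
  inverseOf : ∀ p q, G.IsObjProp p → G.IsObjProp q → G.Has p .owlInverseOf q →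
    ∀ x y, M.op p x y ↔ M.op q y x
  functionalObject : ∀ p, G.IsObjProp p → G.Has p .rdfType (IRI.voc .owlFunctionalProperty) →
    ∀ x y z, M.op p x y → M.op p x z → y = z
  functionalData : ∀ p, G.IsDataProp p → G.Has p .rdfType (IRI.voc .owlFunctionalProperty) →
    ∀ x y z, M.dp p x y → M.dp p x z → y = z
  inverseFunctional : ∀ p, G.IsObjProp p →
    G.Has p .rdfType (IRI.voc .owlInverseFunctionalProperty) →
    ∀ x y z, M.op p x z → M.op p y z → x = y
  reflexive : ∀ p, G.IsObjProp p → G.Has p .rdfType (IRI.voc .owlReflexiveProperty) →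
    ∀ x, M.op p x x
  irreflexive : ∀ p, G.IsObjProp p → G.Has p .rdfType (IRI.voc .owlIrreflexiveProperty) →
    ∀ x, ¬ M.op p x x
  symmetric : ∀ p, G.IsObjProp p → G.Has p .rdfType (IRI.voc .owlSymmetricProperty) →
    ∀ x y, M.op p x y → M.op p y x
  asymmetric : ∀ p, G.IsObjProp p → G.Has p .rdfType (IRI.voc .owlAsymmetricProperty) →
    ∀ x y, M.op p x y → ¬ M.op p y x
  transitive : ∀ p, G.IsObjProp p → G.Has p .rdfType (IRI.voc .owlTransitiveProperty) →
    ∀ x y z, M.op p x y → M.op p y z → M.op p x z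

/-- `G` has a model. -/
def OWLConsistent (G : Graph) : Prop := ∃ M : OWLInterp, M.IsModel G

/-! ## Direct mappings and their properties -/

/-- A direct mapping sends each schema, set of PKs and FKs and instance to an RDF graph. -/
abbrev DirectMapping := (S : Schema) → ConstraintSet S → DBInstance S → Graph

/-- Finite descriptions of databases: a list of pairs (relation, attribute) and a list of pairs
(relation, row), where a row lists the non-null values of a tuple. -/
abbrev DBCode := List (Name × Name) × List (Name × List (Name × Val))

def DBCode.schema (c : DBCode) : Schema where
  rels := (c.1.map Prod.fst).toFinset
  att R := ((c.1.filter (fun p => p.1 = R)).map Prod.snd).toFinset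
  att_nonempty := by
    intro R hR
    simp only [List.mem_toFinset, List.mem_map] at hR
    obtain ⟨p, hp, rfl⟩ := hR
    exact ⟨p.2, by simp only [List.mem_toFinset, List.mem_map]; exact ⟨p, by simp [hp], rfl⟩⟩
  att_out := by
    intro R hR
    ext A
    simp only [List.mem_toFinset, List.mem_map] at hR ⊢
    simp only [List.mem_filter, decide_eq_true_eq, Finset.notMem_empty, iff_false]
    rintro ⟨p, ⟨hp, hpR⟩, _⟩
    exact hR ⟨p, hp, hpR⟩

/-- The tuple of the relation `R` described by a row. -/
def DBCode.tuple (c : DBCode) (R : Name) (row : List (Name × Val)) : Tuple :=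
  fun A => if A ∈ c.schema.att R then row.lookup A else none

def DBCode.inst (c : DBCode) : DBInstance c.schema where
  rows R := {t | R ∈ c.schema.rels ∧ ∃ row, (R, row) ∈ c.2 ∧ t = c.tuple R row}
  finite := by
    intro R
    refine (Set.Finite.image (fun p : Name × List (Name × Val) => c.tuple R p.2)
      (List.finite_toSet c.2)).subset ?_
    rintro t ⟨_, row, hrow, rfl⟩
    exact ⟨(R, row), hrow, rfl⟩
  supp := by
    rintro R t ⟨_, row, _, rfl⟩ A hA
    simp [DBCode.tuple, hA]
  rows_out := by
    intro R hR
    ext t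
    simp [hR]

/-- The database described by a code. -/
def DBCode.toDB (c : DBCode) : DB := ⟨c.schema, c.inst⟩

/-- `N` is computable: an algorithm turns every list of the triples of a graph `G` into a
description of the database `N G`. -/
def ComputableGraphMap (N : Graph → DB) : Prop :=
  ∃ f : List Triple → DBCode, Computable f ∧ ∀ l : List Triple, N l.toFinset = (f l).toDB

def InformationPreserving (M : DirectMapping) : Prop :=
  ∃ N : Graph → DB, ComputableGraphMap N ∧
    ∀ (S : Schema) (K : ConstraintSet S) (I : DBInstance S), I.Models K → N (M S K I) = ⟨S, I⟩

/-- Query preservation; schemas without any relation name are left out. -/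
def QueryPreserving (M : DirectMapping) : Prop :=
  ∀ (S : Schema), S.rels.Nonempty → ∀ (K : ConstraintSet S) (Q : RAExpr), Q.WF S →
    ∃ P : Pattern, P.WF ∧ P.NonParametric ∧
      ∀ I : DBInstance S, I.Models K → tr '' Q.eval I = P.eval (M S K I)

def SemanticsPreserving (M : DirectMapping) : Prop :=
  ∀ (S : Schema) (K : ConstraintSet S) (I : DBInstance S),
    I.Models K ↔ OWLConsistent (M S K I)

def Monotone (M : DirectMapping) : Prop :=
  ∀ (S : Schema) (K : ConstraintSet S) (I₁ I₂ : DBInstance S),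
    (∀ R ∈ S.rels, I₁.rows R ⊆ I₂.rows R) → M S K I₁ ⊆ M S K I₂

/-! ## The direct mapping: ontology extracted from the schema -/

section Ontology

variable {S : Schema} (K : ConstraintSet S)

def PK (as : List Name) (R : Name) : Prop := Constraint.key R as ∈ K.cs

def FK (as : List Name) (R : Name) (bs : List Name) (T : Name) : Prop :=
  Constraint.fk R as T bs ∈ K.cs

def HasPK (R : Name) : Prop := ∃ as, PK K as R

def ThreeAttr (S : Schema) (R : Name) : Prop :=
  ∃ X ∈ S.att R, ∃ Y ∈ S.att R, ∃ Z ∈ S.att R, X ≠ Y ∧ X ≠ Z ∧ Y ≠ Z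

def TwoFK (X R : Name) : Prop :=
  ∃ U₁ V₁ U₂ V₂, FK K [X] R [U₁] V₁ ∧ FK K [X] R [U₂] V₂ ∧ (U₁ ≠ U₂ ∨ V₁ ≠ V₂)

def FKFrom (X Y R : Name) : Prop :=
  ∃ U V W, FK K [X, Y] R [U, V] W ∨ FK K [Y, X] R [U, V] W

def FKTo (R : Name) : Prop :=
  (∃ U Y V, FK K [U] Y [V] R) ∨ ∃ U₁ U₂ Y V₁ V₂, FK K [U₁, U₂] Y [V₁, V₂] R

/-- `R` is a binary relation between `T₁` and `T₂`: its attributes `A`, `B` form its primary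
key and reference the attribute `C` of `T₁` and the attribute `D` of `T₂`. -/
def BinRel (R A B T₁ C T₂ D : Name) : Prop :=
  PK K [A, B] R ∧ ¬ ThreeAttr S R ∧
  FK K [A] R [C] T₁ ∧ R ≠ T₁ ∧ FK K [B] R [D] T₂ ∧ R ≠ T₂ ∧
  ¬ TwoFK K A R ∧ ¬ TwoFK K B R ∧ ¬ FKFrom K A B R ∧ ¬ FKTo K R

def IsBinRel (R : Name) : Prop := ∃ A B T₁ C T₂ D, BinRel K R A B T₁ C T₂ D

/-- Classes are the relations that are not binary relations. -/
def IsClass (R : Name) : Prop := R ∈ S.rels ∧ ¬ IsBinRel K R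

/-- Object properties given by foreign keys of relations that are not binary relations. -/
def ObjP (as bs : List Name) (R T : Name) : Prop := FK K as R bs T ∧ ¬ IsBinRel K R

/-- Data type properties: the attributes of relations that are not binary relations. -/
def DataP (A R : Name) : Prop := R ∈ S.rels ∧ A ∈ S.att R ∧ ¬ IsBinRel K R

end Ontology

/-! ## The direct mapping: IRIs and blank nodes -/

/-- Concatenation of words separated by commas. -/
def commaSep (ws : List Word) : Word := List.intercalate comma ws

def classIRI (base : Word) (R : Name) : IRI := IRI.res (base ++ emb R)

def dataIRI (base : Word) (A R : Name) : IRI := IRI.res (base ++ emb R ++ hash ++ emb A)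

/-- The IRI of the object property of a binary relation. -/
def binIRI (base : Word) (R A B C D : Name) : IRI :=
  IRI.res (base ++ emb R ++ hash ++ commaSep [emb A, emb B, emb C, emb D])

/-- The IRI of the object property of a foreign key. -/
def fkIRI (base : Word) (as bs : List Name) (R T : Name) : IRI :=
  IRI.res (base ++ emb R ++ comma ++ emb T ++ hash ++ commaSep ((as ++ bs).map emb))

/-- The IRI of a tuple of `R` with values `vs` in the primary key `as`. -/
def rowIRI (base : Word) (R : Name) (as : List Name) (vs : List Val) : IRI :=
  IRI.res (base ++ emb R ++ hash ++
    commaSep (List.zipWith (fun A v => emb A ++ eqSign ++ emb v) as vs))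

/-- Tuple identifiers: in each instance, each tuple has an identifier, such that distinct tuples
of the database get distinct blank node labels (relation name followed by identifier). -/
structure TupleIds where
  ident : (S : Schema) → DBInstance S → Name → Tuple → Word
  distinct : ∀ (S : Schema) (I : DBInstance S) (R R' : Name) (t t' : Tuple),
    t ∈ I.rows R → t' ∈ I.rows R' →
    emb R ++ ident S I R t = emb R' ++ ident S I R' t' → R = R' ∧ t = t'

/-- Such identifiers exist. -/
instance : Nonempty TupleIds := by
  have h : ∀ (S : Schema) (I : DBInstance S) (R : Name), ∃ e : Tuple → ℕ,
      Set.InjOn e (I.rows R) := fun S I R =>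
    Set.countable_iff_exists_injOn.1 (I.finite R).countable
  choose e he using h
  have aux : ∀ (a b : Name) (u v : Word),
      emb a ++ (hash ++ u) = emb b ++ (hash ++ v) → a = b ∧ u = v := by
    intro a
    induction a with
    | nil =>
      intro b u v h
      cases b with
      | nil => simpa [emb] using h
      | cons y b => simp [emb] at h
    | cons x a ih =>
      intro b u v h
      cases b with
      | nil => simp [emb] at h
      | cons y b =>
        simp only [emb, List.map_cons, List.cons_append, List.cons.injEq, Sum.inl.injEq] at h
        obtain ⟨h1, h2⟩ := ih b u v h.2
        exact ⟨by rw [h.1, h1], h2⟩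
  refine ⟨⟨fun S I R t => hash ++ emb (List.replicate (e S I R t) 0), ?_⟩⟩
  intro S I R R' t t' ht ht' h
  obtain ⟨rfl, h2⟩ := aux _ _ _ _ h
  refine ⟨rfl, he S I R ht ht' ?_⟩
  simpa [emb] using congrArg List.length h2

section Mapping

variable (base : Word) (ids : TupleIds) {S : Schema} (K : ConstraintSet S) (I : DBInstance S)

/-- `x` is the IRI or blank node that identifies the tuple `t` of the class `R`. Tuples of a
relation with a primary key get an IRI (built from strings, so from non-null values), the others
a blank node. -/
inductive RowId : Name → Tuple → Node → Prop
  | iri (R : Name) (as : List Name) (t : Tuple) (vs : List Val) :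
      IsClass K R → PK K as R → t ∈ I.rows R → as.map t = vs.map some →
      RowId R t (Node.iri (rowIRI base R as vs))
  | blank (R : Name) (t : Tuple) :
      IsClass K R → ¬ HasPK K R → t ∈ I.rows R →
      RowId R t (Node.blank (emb R ++ ids.ident S I R t))

/-- The rules of the direct mapping `DM`. -/
inductive DMTriple : Node → IRI → Term → Prop
  | cls (R : Name) : IsClass K R →
      DMTriple (Node.iri (classIRI base R)) (IRI.voc .rdfType)
        (Term.iri (IRI.voc .owlClass))
  | binObj (R A B T₁ C T₂ D : Name) : BinRel K R A B T₁ C T₂ D →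
      DMTriple (Node.iri (binIRI base R A B C D)) (IRI.voc .rdfType)
        (Term.iri (IRI.voc .owlObjectProperty))
  | binDomain (R A B T₁ C T₂ D : Name) : BinRel K R A B T₁ C T₂ D → IsClass K T₁ →
      DMTriple (Node.iri (binIRI base R A B C D)) (IRI.voc .rdfsDomain)
        (Term.iri (classIRI base T₁))
  | binRange (R A B T₁ C T₂ D : Name) : BinRel K R A B T₁ C T₂ D → IsClass K T₂ →
      DMTriple (Node.iri (binIRI base R A B C D)) (IRI.voc .rdfsRange)
        (Term.iri (classIRI base T₂))
  | fkObj (as bs : List Name) (R T : Name) : ObjP K as bs R T →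
      DMTriple (Node.iri (fkIRI base as bs R T)) (IRI.voc .rdfType)
        (Term.iri (IRI.voc .owlObjectProperty))
  | fkDomain (as bs : List Name) (R T : Name) : ObjP K as bs R T → IsClass K R →
      DMTriple (Node.iri (fkIRI base as bs R T)) (IRI.voc .rdfsDomain)
        (Term.iri (classIRI base R))
  | fkRange (as bs : List Name) (R T : Name) : ObjP K as bs R T → IsClass K T →
      DMTriple (Node.iri (fkIRI base as bs R T)) (IRI.voc .rdfsRange)
        (Term.iri (classIRI base T))
  | data (A R : Name) : DataP K A R →
      DMTriple (Node.iri (dataIRI base A R)) (IRI.voc .rdfType)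
        (Term.iri (IRI.voc .owlDatatypeProperty))
  | dataDomain (A R : Name) : DataP K A R → IsClass K R →
      DMTriple (Node.iri (dataIRI base A R)) (IRI.voc .rdfsDomain)
        (Term.iri (classIRI base R))
  | table (R : Name) (t : Tuple) (x : Node) : RowId base ids K I R t x →
      DMTriple x (IRI.voc .rdfType) (Term.iri (classIRI base R))
  | binRef (R A B T₁ C T₂ D : Name) (t t₁ t₂ : Tuple) (x₁ x₂ : Node) :
      BinRel K R A B T₁ C T₂ D → t ∈ I.rows R → t A = t₁ C → t B = t₂ D →
      RowId base ids K I T₁ t₁ x₁ → RowId base ids K I T₂ t₂ x₂ →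
      DMTriple x₁ (binIRI base R A B C D) (Term.node x₂)
  | fkRef (as bs : List Name) (R T : Name) (t₁ t₂ : Tuple) (x₁ x₂ : Node) :
      ObjP K as bs R T → as.map t₁ = bs.map t₂ →
      RowId base ids K I R t₁ x₁ → RowId base ids K I T t₂ x₂ →
      DMTriple x₁ (fkIRI base as bs R T) (Term.node x₂)
  | literal (A R : Name) (t : Tuple) (v : Val) (x : Node) :
      DataP K A R → t A = some v → RowId base ids K I R t x →
      DMTriple x (dataIRI base A R) (Term.lit v)

/-- The attributes `as` of `R` are violated as a key: a value is repeated or null. -/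
inductive KeyViolation (R : Name) (as : List Name) : Prop
  | repeated (t₁ t₂ : Tuple) : t₁ ∈ I.rows R → t₂ ∈ I.rows R → t₁ ≠ t₂ →
      (∀ A ∈ as, t₁ A = t₂ A) → KeyViolation R as
  | null (t : Tuple) (A : Name) : t ∈ I.rows R → A ∈ as → t A = none → KeyViolation R as

/-- `IsValue_n`: some tuple of `T` has the values `vs` in the attributes `bs`. -/
def IsValue (vs : List Val) (bs : List Name) (T : Name) : Prop :=
  ∃ s ∈ I.rows T, bs.map s = vs.map some

/-- Detection of violations: of a primary key, of the inclusion required by a foreign key, and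
of the key referenced by a foreign key. -/
inductive Violation : Prop
  | pk (as : List Name) (R : Name) : PK K as R → KeyViolation I R as → Violation
  | fk (as : List Name) (R : Name) (bs : List Name) (T : Name) (t : Tuple) (vs : List Val) :
      FK K as R bs T → t ∈ I.rows R → as.map t = vs.map some → ¬ IsValue I vs bs T → Violation
  | fkKey (as : List Name) (R : Name) (bs : List Name) (T : Name) :
      FK K as R bs T → KeyViolation I T bs → Violation

/-- The triples of `DM_pk+fk`: those of `DM`, and `(a, owl:differentFrom, a)` if there is a
violation. -/
def dmpkfkTriples (a : Word) : Set Triple :=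
  {g | DMTriple base ids K I g.1 g.2.1 g.2.2 ∨
    (Violation K I ∧ g = (Node.iri (IRI.res a), IRI.voc .owlDifferentFrom, Term.iri (IRI.res a)))}

theorem rowIds_finite : {x : Node | ∃ R t, RowId base ids K I R t x}.Finite := by
  let f : Name → Constraint → Tuple → Node := fun R c t => match c with
    | .key _ as => Node.iri (rowIRI base R as (as.filterMap t))
    | .fk _ _ _ _ => Node.iri (classIRI base R)
  have h1 : (⋃ R ∈ S.rels, ⋃ c ∈ K.cs, f R c '' I.rows R).Finite :=
    S.rels.finite_toSet.biUnion fun R _ => K.cs.finite_toSet.biUnion fun c _ =>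
      (I.finite R).image _
  have h2 : (⋃ R ∈ S.rels, (fun t : Tuple => Node.blank (emb R ++ ids.ident S I R t)) ''
      I.rows R).Finite := S.rels.finite_toSet.biUnion fun R _ => (I.finite R).image _
  refine (h1.union h2).subset ?_
  rintro x ⟨R, t, h⟩
  cases h with
  | iri as _ vs hc hpk ht hv =>
    left
    simp only [Set.mem_iUnion]
    refine ⟨R, hc.1, _, hpk, t, ht, ?_⟩
    have : as.filterMap t = vs := by
      have h3 : (as.map t).filterMap id = (vs.map some).filterMap id := by rw [hv]
      simpa [List.filterMap_map] using h3
    simp [f, this]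
  | blank _ hc hpk ht =>
    right
    simp only [Set.mem_iUnion]
    exact ⟨R, hc.1, t, ht, rfl⟩

theorem dmpkfkTriples_finite (a : Word) : (dmpkfkTriples base ids K I a).Finite := by
  -- names, class IRIs, data property IRIs, object property IRIs
  let names : Finset Name := S.rels ∪ S.rels.biUnion S.att
  let C : Set IRI := classIRI base '' names
  let D : Set IRI := Set.image2 (dataIRI base) names names
  let B : Set IRI := (fun p : Name × Name × Name × Name × Name =>
    binIRI base p.1 p.2.1 p.2.2.1 p.2.2.2.1 p.2.2.2.2) '' (names ×ˢ names ×ˢ names ×ˢ names ×ˢ names : Finset _)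
  let F : Set IRI := (fun c : Constraint => match c with
    | .key R _ => classIRI base R
    | .fk R as T bs => fkIRI base as bs R T) '' K.cs
  let W : Set IRI := Set.range IRI.voc ∪ {IRI.res a} ∪ C ∪ D ∪ B ∪ F
  let N : Set Node := Node.iri '' W ∪ {x : Node | ∃ R t, RowId base ids K I R t x}
  let L : Set Val := ⋃ R ∈ S.rels, ⋃ A ∈ names, (fun t : Tuple => (t A).getD []) '' I.rows R
  have hW : W.Finite := by
    have hC : C.Finite := names.finite_toSet.image _
    have hD : D.Finite := Set.Finite.image2 _ names.finite_toSet names.finite_toSet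
    have hB : B.Finite := (Finset.finite_toSet _).image _
    have hF : F.Finite := K.cs.finite_toSet.image _
    exact (((((Set.finite_range _).union (Set.finite_singleton _)).union hC).union hD).union
      hB).union hF
  have hN : N.Finite := (hW.image _).union (rowIds_finite base ids K I)
  have hL : L.Finite := S.rels.finite_toSet.biUnion fun R _ => names.finite_toSet.biUnion
    fun A _ => (I.finite R).image _
  have hT : (Term.node '' N ∪ Term.lit '' L).Finite := (hN.image _).union (hL.image _)
  refine (hN.prod (hW.prod hT)).subset ?_
  have hvoc : ∀ v, IRI.voc v ∈ W := fun v => by simp [W]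
  have hrel : ∀ R ∈ S.rels, R ∈ names := fun R h => by simp [names, h]
  have hatt : ∀ R ∈ S.rels, ∀ A ∈ S.att R, A ∈ names := fun R h A hA => by
    simp only [names, Finset.mem_union, Finset.mem_biUnion]; exact Or.inr ⟨R, h, hA⟩
  have hcls : ∀ R ∈ S.rels, classIRI base R ∈ W := fun R h => by
    have : classIRI base R ∈ C := ⟨R, hrel R h, rfl⟩
    simp [W, this]
  have hdata : ∀ R A, DataP K A R → dataIRI base A R ∈ W := fun R A h => by
    have : dataIRI base A R ∈ D := ⟨A, hatt R h.1 A h.2.1, R, hrel R h.1, rfl⟩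
    simp [W, this]
  have hbin : ∀ R A B' T₁ C' T₂ D', BinRel K R A B' T₁ C' T₂ D' →
      binIRI base R A B' C' D' ∈ W := fun R A B' T₁ C' T₂ D' h => by
    obtain ⟨h1, -, h2, -, h3, -⟩ := h
    have w1 := K.wf _ h1
    have w2 := K.wf _ h2
    have w3 := K.wf _ h3
    simp only [Constraint.WF] at w1 w2 w3
    have : binIRI base R A B' C' D' ∈ B := by
      refine ⟨(R, A, B', C', D'), ?_, rfl⟩
      simp only [Finset.coe_product, Set.mem_prod, Finset.mem_coe]
      exact ⟨hrel R w1.1, hatt R w1.1 _ (w1.2.2.2 A (by simp)),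
        hatt R w1.1 _ (w1.2.2.2 B' (by simp)),
        hatt T₁ w2.2.2.2.2.1 _ (w2.2.2.2.2.2.2.1 C' (by simp)),
        hatt T₂ w3.2.2.2.2.1 _ (w3.2.2.2.2.2.2.1 D' (by simp))⟩
    simp [W, this]
  have hfk : ∀ as bs R T, ObjP K as bs R T → fkIRI base as bs R T ∈ W := fun as bs R T h => by
    have : fkIRI base as bs R T ∈ F := ⟨_, h.1, rfl⟩
    simp [W, this]
  have hWN : ∀ u ∈ W, Node.iri u ∈ N := fun u h => Or.inl ⟨u, h, rfl⟩
  have hNT : ∀ x ∈ N, Term.node x ∈ Term.node '' N ∪ Term.lit '' L := fun x h =>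
    Or.inl ⟨x, h, rfl⟩
  have hrow : ∀ R t x, RowId base ids K I R t x → x ∈ N := fun R t x h => Or.inr ⟨R, t, h⟩
  have hrowR : ∀ R t x, RowId base ids K I R t x → R ∈ S.rels ∧ t ∈ I.rows R := by
    intro R t x h
    cases h with
    | iri _ _ _ hc _ ht _ => exact ⟨hc.1, ht⟩
    | blank _ hc _ ht => exact ⟨hc.1, ht⟩
  rintro ⟨x, p, y⟩ (h | ⟨-, h⟩)
  · simp only at h
    cases h with
    | cls R h => exact ⟨hWN _ (hcls R h.1), hvoc _, hNT _ (hWN _ (hvoc _))⟩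
    | binObj R A B' T₁ C' T₂ D' h =>
      exact ⟨hWN _ (hbin _ _ _ _ _ _ _ h), hvoc _, hNT _ (hWN _ (hvoc _))⟩
    | binDomain R A B' T₁ C' T₂ D' h h' =>
      exact ⟨hWN _ (hbin _ _ _ _ _ _ _ h), hvoc _, hNT _ (hWN _ (hcls _ h'.1))⟩
    | binRange R A B' T₁ C' T₂ D' h h' =>
      exact ⟨hWN _ (hbin _ _ _ _ _ _ _ h), hvoc _, hNT _ (hWN _ (hcls _ h'.1))⟩
    | fkObj as bs R T h => exact ⟨hWN _ (hfk _ _ _ _ h), hvoc _, hNT _ (hWN _ (hvoc _))⟩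
    | fkDomain as bs R T h h' =>
      exact ⟨hWN _ (hfk _ _ _ _ h), hvoc _, hNT _ (hWN _ (hcls _ h'.1))⟩
    | fkRange as bs R T h h' =>
      exact ⟨hWN _ (hfk _ _ _ _ h), hvoc _, hNT _ (hWN _ (hcls _ h'.1))⟩
    | data A R h => exact ⟨hWN _ (hdata _ _ h), hvoc _, hNT _ (hWN _ (hvoc _))⟩
    | dataDomain A R h h' => exact ⟨hWN _ (hdata _ _ h), hvoc _, hNT _ (hWN _ (hcls _ h'.1))⟩
    | table R t x h => exact ⟨hrow _ _ _ h, hvoc _, hNT _ (hWN _ (hcls _ (hrowR _ _ _ h).1))⟩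
    | binRef R A B' T₁ C' T₂ D' t t₁ t₂ x₁ x₂ h _ _ _ h1 h2 =>
      exact ⟨hrow _ _ _ h1, hbin _ _ _ _ _ _ _ h, hNT _ (hrow _ _ _ h2)⟩
    | fkRef as bs R T t₁ t₂ x₁ x₂ h _ h1 h2 =>
      exact ⟨hrow _ _ _ h1, hfk _ _ _ _ h, hNT _ (hrow _ _ _ h2)⟩
    | literal A R t v x h hv h1 =>
      refine ⟨hrow _ _ _ h1, hdata _ _ h, Or.inr ⟨v, ?_, rfl⟩⟩
      simp only [L, Set.mem_iUnion]
      exact ⟨R, h.1, A, hatt R h.1 A h.2.1, t, (hrowR _ _ _ h1).2, by simp [hv]⟩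
  · simp only [Prod.mk.injEq] at h
    obtain ⟨rfl, rfl, rfl⟩ := h
    have ha : IRI.res a ∈ W := by simp [W]
    exact ⟨hWN _ ha, hvoc _, hNT _ (hWN _ ha)⟩

end Mapping

/-- The direct mapping `DM_pk+fk` with base IRI `base`, tuple identifiers `ids` and the IRI `a`
used in the triple that signals violations. -/
def DMpkfk (base : Word) (ids : TupleIds) (a : Word) : DirectMapping := fun _ K I =>
  (dmpkfkTriples_finite base ids K I a).toFinset

end

end DirMap

/-!
The graph of an instance `I` that satisfies the constraints consists of the triples `DMTriple`
alone, and three facts about these carry most of the proof.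

* The generated IRIs can be read back. Cutting an IRI behind the base at its separators (`fields`)
  gives one field for a class, two for an attribute, five for a binary relation, an even number of
  at least four for a foreign key; for a tuple the fields are the relation followed by the key
  attributes with their values. So properties of different kinds do not clash, and IRIs of the
  same kind determine what they are built from.
* Among the tuples of a legal instance, a node identifies one tuple of one relation
  (`RowId.injective`).
* A binary relation only references classes (`BinRel.isClass`), so its tuples are recovered from
  the links between nodes and the referenced attribute values (`dmTriple_bin`,
  `BinRel.exists_refs`).

*Information.* `dbCode` reads schema and tuples off a list of triples. It is primitive recursive,
and to make it a function of the graph the list is first put into a canonical order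
(`canonicalList`).

*Queries.* By induction on the query, its answers are `Translatable`: they are the answers of a
pattern whose visible variables may be prescribed and whose other variables avoid any given
finite set. With this freedom, renaming is a choice of variables and a projection never reuses a
variable that it hides. A tuple of a class is collected by a chain of OPTs (`classBody`), one for
each attribute, as null values have no triple. Filters do not compare with literals, so a constant
is obtained from the attribute values of the graph, among which all values in answers occur
(`translatable_const`, `RAExpr.eval_mem_class`). Difference is not MINUS, since a null is
compatible with every value and MINUS keeps mappings with disjoint domains:
`Translatable.antijoin` uses OPT and an unbound variable, and `Translatable.diff` first splits
the tuples on which attributes are null.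

*Consistency and monotonicity.* The triples of `DMTriple` hold in an interpretation with one
element (`fullInterp`), whereas the triple that signals a violation has no model. That triple
disappears when the violation is repaired by inserting a tuple.
-/

namespace DirMap

/-! ### Splitting words at separators -/

/-- The maximal blocks of letters of a word, in order: the word cut at every separator, whichever
separator it is. -/
def fields (w : Word) : List Name :=
  w.foldr (fun s L => s.casesOn (fun n => (n :: L.headI) :: L.tail) fun _ => [] :: L) [[]]

@[simp] theorem fields_nil : fields [] = [[]] := rfl

@[simp] theorem fields_inl_cons (n : ℕ) (w : Word) :
    fields (Sum.inl n :: w) = (n :: (fields w).headI) :: (fields w).tail := rfl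

@[simp] theorem fields_inr_cons (s : Sep) (w : Word) :
    fields (Sum.inr s :: w) = [] :: fields w := rfl

theorem fields_append_sep (u w : Word) (s : Sep) :
    fields (u ++ [Sum.inr s] ++ w) = fields u ++ fields w := by
  induction u with
  | nil => simp
  | cons x u ih =>
    cases x with
    | inl n =>
      have h : fields u ≠ [] := by
        cases u with
        | nil => simp
        | cons y u => cases y <;> simp
      obtain ⟨a, L, hL⟩ := List.exists_cons_of_ne_nil h
      simp only [List.cons_append, fields_inl_cons, ih, hL]
      simp
    | inr s' => simp only [List.cons_append, fields_inr_cons, ih]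

@[simp] theorem fields_emb (u : List ℕ) : fields (emb u) = [u] := by
  induction u with
  | nil => rfl
  | cons n u ih =>
    have : emb (n :: u) = Sum.inl n :: emb u := rfl
    rw [this, fields_inl_cons, ih]; rfl

theorem fields_commaSep (ws : List Word) (h : ws ≠ []) :
    fields (commaSep ws) = ws.flatMap fields := by
  induction ws with
  | nil => exact absurd rfl h
  | cons u ws ih =>
    cases ws with
    | nil => simp [commaSep, List.intercalate]
    | cons v ws =>
      have : commaSep (u :: v :: ws) = u ++ [Sum.inr Sep.comma] ++ commaSep (v :: ws) := by
        simp [commaSep, List.intercalate, comma, List.intersperse]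
      rw [this, fields_append_sep, ih (by simp)]
      rfl

/-- The fields of an IRI behind the base IRI, where the base itself is skipped without being
compared. For generated IRIs the fields are the names and values that they are built from; their
number tells classes, attributes, binary relations and foreign keys apart. Reserved IRIs have no
fields. -/
def iriFields (base : Word) : IRI → List Name :=
  fun u => u.casesOn (fun _ => []) fun w => fields (w.drop base.length)

section IRIs

variable (base : Word)

@[simp] theorem iriFields_voc (v : Vocab) : iriFields base (IRI.voc v) = [] := rfl

@[simp] theorem iriFields_class (R : Name) : iriFields base (classIRI base R) = [R] := by
  simp [iriFields, classIRI, IRI.res]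

@[simp] theorem iriFields_data (A R : Name) : iriFields base (dataIRI base A R) = [R, A] := by
  have := fields_append_sep (emb R) (emb A) Sep.hash
  simpa [iriFields, dataIRI, IRI.res] using this

@[simp] theorem iriFields_bin (R A B C D : Name) :
    iriFields base (binIRI base R A B C D) = [R, A, B, C, D] := by
  have := fields_append_sep (emb R) (commaSep [emb A, emb B, emb C, emb D]) Sep.hash
  rw [fields_commaSep _ (by simp)] at this
  simpa [iriFields, binIRI, IRI.res] using this

theorem flatMap_fields_emb (l : List Name) : (l.map emb).flatMap fields = l := by
  induction l with
  | nil => rfl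
  | cons a l ih => simp [ih]

theorem iriFields_fk (as bs : List Name) (R T : Name) (h : as ≠ []) :
    iriFields base (fkIRI base as bs R T) = R :: T :: (as ++ bs) := by
  have hd : (base ++ emb R ++ comma ++ emb T ++ hash ++ commaSep ((as ++ bs).map emb)).drop
      base.length = emb R ++ [Sum.inr Sep.comma] ++ emb T ++ [Sum.inr Sep.hash] ++
        commaSep ((as ++ bs).map emb) := by simp
  change fields (List.drop _ _) = _
  rw [hd, fields_append_sep, fields_append_sep, fields_emb, fields_emb,
    fields_commaSep _ (by simp [h]), flatMap_fields_emb]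
  rfl

theorem flatMap_fields_zipWith (as : List Name) (vs : List Val) :
    (List.zipWith (fun A v => emb A ++ eqSign ++ emb v) as vs).flatMap fields =
      (List.zipWith (fun A v => [A, v]) as vs).flatten := by
  induction as generalizing vs with
  | nil => rfl
  | cons A as ih =>
    cases vs with
    | nil => rfl
    | cons v vs =>
      simp only [List.zipWith_cons_cons, List.flatMap_cons, ih, List.flatten_cons]
      rw [fields_append_sep]
      simp

theorem iriFields_row (R : Name) (as : List Name) (vs : List Val) (h : as ≠ [])
    (hl : as.length = vs.length) :
    iriFields base (rowIRI base R as vs) =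
      R :: (List.zipWith (fun A v => [A, v]) as vs).flatten := by
  have h0 : List.zipWith (fun A v => emb A ++ eqSign ++ emb v) as vs ≠ [] := by
    cases as with
    | nil => exact absurd rfl h
    | cons a as =>
      cases vs with
      | nil => simp at hl
      | cons v vs => simp
  have h1 := fields_append_sep (emb R)
    (commaSep (List.zipWith (fun A v => emb A ++ eqSign ++ emb v) as vs)) Sep.hash
  rw [fields_commaSep _ h0, flatMap_fields_zipWith] at h1
  simpa [iriFields, rowIRI, IRI.res] using h1

theorem zipWith_pair_flatten_inj (as : List Name) : ∀ (vs ws : List Val),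
    as.length = vs.length → as.length = ws.length →
    (List.zipWith (fun A v => [A, v]) as vs).flatten =
      (List.zipWith (fun A v => [A, v]) as ws).flatten → vs = ws := by
  induction as with
  | nil =>
    intro vs ws h1 h2 _
    rw [List.length_eq_zero_iff.1 h1.symm, List.length_eq_zero_iff.1 h2.symm]
  | cons A as ih =>
    intro vs ws h1 h2 h
    cases vs with
    | nil => simp at h1
    | cons v vs =>
      cases ws with
      | nil => simp at h2
      | cons w ws =>
        simp only [List.zipWith_cons_cons, List.flatten_cons, List.cons_append,
          List.cons.injEq, true_and, List.nil_append] at h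
        rw [h.1, ih vs ws (by simpa using h1) (by simpa using h2) h.2]

end IRIs

/-! ### Classes and binary relations -/

section Relations

variable {S : Schema} {K : ConstraintSet S}

theorem BinRel.ne {R A B T₁ C T₂ D : Name} (h : BinRel K R A B T₁ C T₂ D) : A ≠ B := by
  have := (K.wf _ h.1).2.2.1
  simpa using this

theorem BinRel.mem_att {R A B T₁ C T₂ D : Name} (h : BinRel K R A B T₁ C T₂ D) (X : Name) :
    X ∈ S.att R ↔ X = A ∨ X = B := by
  have hw := (K.wf _ h.1).2.2.2
  have hA : A ∈ S.att R := hw A (by simp)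
  have hB : B ∈ S.att R := hw B (by simp)
  constructor
  · intro hX
    by_contra! hne
    exact h.2.1 ⟨X, hX, A, hA, B, hB, hne.1, hne.2, h.ne⟩
  · rintro (rfl | rfl) <;> assumption

/-- A binary relation references classes: no binary relation is referenced by a foreign key with
one attribute. -/
theorem BinRel.isClass {R A B T₁ C T₂ D : Name} (h : BinRel K R A B T₁ C T₂ D) :
    IsClass K T₁ ∧ IsClass K T₂ := by
  obtain ⟨-, -, h1, -, h2, -⟩ := h
  have aux : ∀ {X T Y : Name}, FK K [X] R [Y] T → IsClass K T := by
    intro X T Y hf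
    refine ⟨(K.wf _ hf).2.2.2.2.1, ?_⟩
    rintro ⟨_, _, _, _, _, _, -, -, -, -, -, -, -, -, -, hto⟩
    exact hto (Or.inl ⟨_, _, _, hf⟩)
  exact ⟨aux h1, aux h2⟩

theorem BinRel.data₁ {R A B T₁ C T₂ D : Name} (h : BinRel K R A B T₁ C T₂ D) :
    DataP K C T₁ :=
  ⟨h.isClass.1.1, (K.wf _ h.2.2.1).2.2.2.2.2.2.1 C (by simp), h.isClass.1.2⟩

theorem BinRel.data₂ {R A B T₁ C T₂ D : Name} (h : BinRel K R A B T₁ C T₂ D) :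
    DataP K D T₂ :=
  ⟨h.isClass.2.1, (K.wf _ h.2.2.2.2.1).2.2.2.2.2.2.1 D (by simp), h.isClass.2.2⟩

/-- The data of a binary relation are determined by its name. -/
theorem BinRel.unique {R A B T₁ C T₂ D A' B' T₁' C' T₂' D' : Name}
    (h : BinRel K R A B T₁ C T₂ D) (h' : BinRel K R A' B' T₁' C' T₂' D') :
    A = A' ∧ B = B' ∧ T₁ = T₁' ∧ C = C' ∧ T₂ = T₂' ∧ D = D' := by
  have hk := K.key_unique _ _ _ h.1 h'.1
  simp only [List.cons.injEq, and_true] at hk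
  obtain ⟨rfl, rfl⟩ := hk
  obtain ⟨-, -, f1, -, f2, -, n1, n2, -⟩ := h
  obtain ⟨-, -, g1, -, g2, -⟩ := h'
  have e1 : ¬ (C ≠ C' ∨ T₁ ≠ T₁') := fun hh => n1 ⟨_, _, _, _, f1, g1, hh⟩
  have e2 : ¬ (D ≠ D' ∨ T₂ ≠ T₂') := fun hh => n2 ⟨_, _, _, _, f2, g2, hh⟩
  push Not at e1 e2
  exact ⟨rfl, rfl, e1.2, e1.1, e2.2, e2.1⟩

theorem exists_isClass (h : S.rels.Nonempty) : ∃ R, IsClass K R := by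
  obtain ⟨R, hR⟩ := h
  by_cases hb : IsBinRel K R
  · obtain ⟨A, B, T₁, C, T₂, D, hb⟩ := hb
    exact ⟨T₁, hb.isClass.1⟩
  · exact ⟨R, hR, hb⟩

theorem FK.length_eq {as bs : List Name} {R T : Name} (h : FK K as R bs T) :
    as.length = bs.length := (K.wf _ h).2.2.2.2.2.2.2

theorem FK.ne_nil {as bs : List Name} {R T : Name} (h : FK K as R bs T) : as ≠ [] :=
  (K.wf _ h).2.1

end Relations

/-! ### The nodes of tuples -/

section Nodes

variable {base : Word} {ids : TupleIds} {S : Schema} {K : ConstraintSet S} {I : DBInstance S}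

theorem RowId.isClass {R : Name} {t : Tuple} {x : Node} (h : RowId base ids K I R t x) :
    IsClass K R := by cases h <;> assumption

theorem RowId.mem_rows {R : Name} {t : Tuple} {x : Node} (h : RowId base ids K I R t x) :
    t ∈ I.rows R := by cases h <;> assumption

/-- In a legal instance, a node identifies a single tuple of a single relation. -/
theorem RowId.injective (hI : I.Models K) {R R' : Name} {t t' : Tuple} {x : Node}
    (h : RowId base ids K I R t x) (h' : RowId base ids K I R' t' x) : R = R' ∧ t = t' := by
  cases h with
  | iri as _ vs hc hk ht hv =>
    generalize hx : Node.iri (rowIRI base R as vs) = x at h'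
    cases h' with
    | iri as' _ vs' hc' hk' ht' hv' =>
      have hl : as.length = vs.length := by simpa using congrArg List.length hv
      have hl' : as'.length = vs'.length := by simpa using congrArg List.length hv'
      have hx := congrArg (iriFields base) (Sum.inl.inj hx)
      rw [iriFields_row _ _ _ _ (K.wf _ hk).2.1 hl, iriFields_row _ _ _ _ (K.wf _ hk').2.1 hl',
        List.cons.injEq] at hx
      obtain ⟨rfl, hflat⟩ := hx
      obtain rfl := K.key_unique _ _ _ hk hk'
      obtain rfl := zipWith_pair_flatten_inj _ _ _ hl hl' hflat
      refine ⟨rfl, (hI _ hk).2 t ht t' ht' ?_⟩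
      exact List.map_inj_left.1 (hv.trans hv'.symm)
    | blank => cases hx
  | blank _ hc hk ht =>
    generalize hx : Node.blank (emb R ++ ids.ident S I R t) = x at h'
    cases h' with
    | iri => cases hx
    | blank _ hc' hk' ht' => exact ids.distinct S I R R' t t' ht ht' (Sum.inr.inj hx)

/-- In a legal instance, every tuple of a class has a node. -/
theorem exists_rowId (hI : I.Models K) {R : Name} {t : Tuple} (hc : IsClass K R)
    (ht : t ∈ I.rows R) : ∃ x, RowId base ids K I R t x := by
  by_cases hk : HasPK K R
  · obtain ⟨as, hk⟩ := hk
    refine ⟨_, RowId.iri R as t (as.map fun A => (t A).getD []) hc hk ht ?_⟩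
    rw [List.map_map]
    refine List.map_congr_left fun A hA => ?_
    obtain ⟨v, hv⟩ := Option.ne_none_iff_exists'.1 ((hI _ hk).1 t ht A hA)
    simp [hv]
  · exact ⟨_, RowId.blank R t hc hk ht⟩

end Nodes

/-! ### The triples of the graph of a legal instance -/

section Triples

variable {base : Word} {ids : TupleIds} {S : Schema} {K : ConstraintSet S} {I : DBInstance S}

theorem models_iff_not_violation : I.Models K ↔ ¬ Violation K I := by
  have aux : ∀ R as, I.SatKey R as ↔ ¬ KeyViolation I R as := by
    intro R as
    constructor
    · rintro ⟨h1, h2⟩ (⟨t₁, t₂, ht₁, ht₂, hne, he⟩ | ⟨t, A, ht, hA, hn⟩)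
      · exact hne (h2 _ ht₁ _ ht₂ he)
      · exact h1 t ht A hA hn
    · intro h
      refine ⟨fun t ht A hA hn => h (.null t A ht hA hn), fun t₁ h₁ t₂ h₂ he => ?_⟩
      by_contra hne
      exact h (.repeated t₁ t₂ h₁ h₂ hne he)
  constructor
  · rintro h (⟨as, R, hk, hv⟩ | ⟨as, R, bs, T, t, vs, hf, ht, hv, hn⟩ | ⟨as, R, bs, T, hf, hv⟩)
    · exact (aux _ _).1 (h _ hk) hv
    · rcases (h _ hf).2 t ht with ⟨A, hA, hAn⟩ | ⟨s, hs, he⟩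
      · have : none ∈ as.map t := List.mem_map.2 ⟨A, hA, hAn⟩
        rw [hv] at this
        simp at this
      · exact hn ⟨s, hs, he.symm.trans hv⟩
    · exact (aux _ _).1 (h _ hf).1 hv
  · intro h c hc
    cases c with
    | key R as => exact (aux _ _).2 fun hv => h (.pk as R hc hv)
    | fk R as T bs =>
      refine ⟨(aux _ _).2 fun hv => h (.fkKey as R bs T hc hv), fun t ht => ?_⟩
      by_contra! hcon
      refine h (.fk as R bs T t (as.map fun A => (t A).getD []) hc ht ?_ ?_)
      · rw [List.map_map]
        refine List.map_congr_left fun A hA => ?_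
        obtain ⟨v, hv⟩ := Option.ne_none_iff_exists'.1 (hcon.1 A hA)
        simp [hv]
      · rintro ⟨s, hs, he⟩
        refine hcon.2 s hs ?_
        rw [he, List.map_map]
        refine List.map_congr_left fun A hA => ?_
        obtain ⟨v, hv⟩ := Option.ne_none_iff_exists'.1 (hcon.1 A hA)
        simp [hv]

theorem mem_DMpkfk {a : Word} {x : Node} {p : IRI} {y : Term} :
    (x, p, y) ∈ DMpkfk base ids a S K I ↔ DMTriple base ids K I x p y ∨
      (Violation K I ∧ x = Node.iri (IRI.res a) ∧ p = IRI.voc .owlDifferentFrom ∧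
        y = Term.iri (IRI.res a)) := by
  simp [DMpkfk, dmpkfkTriples]

theorem mem_DMpkfk_of_models {a : Word} (hI : I.Models K) {x : Node} {p : IRI} {y : Term} :
    (x, p, y) ∈ DMpkfk base ids a S K I ↔ DMTriple base ids K I x p y := by
  rw [mem_DMpkfk]
  simp [models_iff_not_violation.1 hI]

theorem dmTriple_type_owlClass {x : Node} :
    DMTriple base ids K I x (IRI.voc .rdfType) (Term.iri (IRI.voc .owlClass)) ↔
      ∃ R, IsClass K R ∧ x = Node.iri (classIRI base R) := by
  constructor
  · intro h
    cases h with
    | cls R h => exact ⟨R, h, rfl⟩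
  · rintro ⟨R, h, rfl⟩
    exact .cls R h

theorem dmTriple_type_class {x : Node} {R : Name} :
    DMTriple base ids K I x (IRI.voc .rdfType) (Term.iri (classIRI base R)) ↔
      ∃ t, RowId base ids K I R t x := by
  constructor
  · intro h
    generalize hp : IRI.voc .rdfType = p at h
    generalize ho : Term.iri (classIRI base R) = o at h
    cases h with
    | table R' t _ h =>
      have := congrArg (iriFields base) (Sum.inl.inj (Sum.inl.inj ho))
      simp only [iriFields_class, List.cons.injEq, and_true] at this
      exact ⟨t, this ▸ h⟩
    | binRef => cases hp
    | fkRef => cases hp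
    | binDomain => cases hp
    | binRange => cases hp
    | fkDomain => cases hp
    | fkRange => cases hp
    | dataDomain => cases hp
    | _ => cases ho
  · rintro ⟨t, h⟩
    exact .table R t x h

/-- A predicate with two fields is that of an attribute. -/
theorem dmTriple_data {x : Node} {A R : Name} {o : Term} :
    DMTriple base ids K I x (dataIRI base A R) o ↔
      ∃ t v, DataP K A R ∧ t A = some v ∧ RowId base ids K I R t x ∧ o = Term.lit v := by
  constructor
  · intro h
    generalize hp : dataIRI base A R = p at h
    have hf := congrArg (iriFields base) hp
    rw [iriFields_data] at hf
    cases h with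
    | literal A' R' t v _ h hv hr =>
      simp only [iriFields_data, List.cons.injEq, and_true] at hf
      obtain ⟨rfl, rfl⟩ := hf
      exact ⟨t, v, h, hv, hr, rfl⟩
    | binRef => simp at hf
    | fkRef as bs R T t₁ t₂ x₁ x₂ h =>
      rw [iriFields_fk _ _ _ _ _ h.1.ne_nil] at hf
      have := h.1.ne_nil
      simp_all
    | _ => simp at hf
  · rintro ⟨t, v, h, hv, hr, rfl⟩
    exact .literal A R t v x h hv hr

/-- A predicate with five fields is that of a binary relation: those of foreign keys have an even
number of fields. -/
theorem dmTriple_bin {x : Node} {p : IRI} {o : Term} (hp : (iriFields base p).length = 5) :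
    DMTriple base ids K I x p o ↔
      ∃ R A B T₁ C T₂ D t t₁ t₂ x₂, p = binIRI base R A B C D ∧ BinRel K R A B T₁ C T₂ D ∧
        t ∈ I.rows R ∧ t A = t₁ C ∧ t B = t₂ D ∧ RowId base ids K I T₁ t₁ x ∧
        RowId base ids K I T₂ t₂ x₂ ∧ o = Term.node x₂ := by
  constructor
  · intro h
    cases h with
    | binRef R A B T₁ C T₂ D t t₁ t₂ x₁ x₂ h ht e1 e2 h1 h2 =>
      exact ⟨R, A, B, T₁, C, T₂, D, t, t₁, t₂, x₂, rfl, h, ht, e1, e2, h1, h2, rfl⟩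
    | fkRef as bs R T t₁ t₂ x₁ x₂ h =>
      rw [iriFields_fk _ _ _ _ _ h.1.ne_nil] at hp
      have := h.1.length_eq
      simp only [List.length_cons, List.length_append] at hp
      omega
    | _ => simp at hp
  · rintro ⟨R, A, B, T₁, C, T₂, D, t, t₁, t₂, x₂, rfl, h, ht, e1, e2, h1, h2, rfl⟩
    exact .binRef R A B T₁ C T₂ D t t₁ t₂ x x₂ h ht e1 e2 h1 h2

/-- A tuple of a binary relation joins one tuple of each of the classes that it references, on
values that are not null. -/
theorem BinRel.exists_refs (hI : I.Models K) {R A B T₁ C T₂ D : Name}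
    (h : BinRel K R A B T₁ C T₂ D) {t : Tuple} (ht : t ∈ I.rows R) :
    ∃ t₁ t₂ x₁ x₂ v w, RowId base ids K I T₁ t₁ x₁ ∧ RowId base ids K I T₂ t₂ x₂ ∧
      t A = some v ∧ t₁ C = some v ∧ t B = some w ∧ t₂ D = some w := by
  have hk := (hI _ h.1).1 t ht
  obtain ⟨v, hv⟩ := Option.ne_none_iff_exists'.1 (hk A (by simp))
  obtain ⟨w, hw⟩ := Option.ne_none_iff_exists'.1 (hk B (by simp))
  have aux : ∀ {X T Y : Name} {u : Val}, FK K [X] R [Y] T → t X = some u → IsClass K T →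
      ∃ s y, RowId base ids K I T s y ∧ s Y = some u := by
    intro X T Y u hf hu hT
    rcases (hI _ hf).2 t ht with ⟨Z, hZ, hn⟩ | ⟨s, hs, he⟩
    · simp only [List.mem_singleton] at hZ
      simp [hZ, hu] at hn
    · obtain ⟨y, hy⟩ := exists_rowId (base := base) (ids := ids) hI hT hs
      simp only [List.map_cons, List.map_nil, List.cons.injEq, and_true] at he
      exact ⟨s, y, hy, he ▸ hu⟩
  obtain ⟨s₁, y₁, hy₁, e₁⟩ := aux h.2.2.1 hv h.isClass.1
  obtain ⟨s₂, y₂, hy₂, e₂⟩ := aux h.2.2.2.2.1 hw h.isClass.2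
  exact ⟨s₁, s₂, y₁, y₂, v, w, hy₁, hy₂, hv, e₁, hw, e₂⟩

end Triples

/-! ### Consistency and monotonicity -/

/-- The model with a single element, in which every class and property other than the empty ones
holds everywhere. -/
def fullInterp : OWLInterp where
  Dom := Unit
  Data := Val
  cls c := {_x | c ≠ IRI.voc .owlNothing}
  op p _ _ := p ≠ IRI.voc .owlBottomObjectProperty
  dp p _ _ := p ≠ IRI.voc .owlBottomDataProperty
  ind _ := ()
  lit := id
  lit_inj := Function.injective_id
  thing := by ext; simp
  nothing := by simp
  topOP := by simp
  bottomOP := by simp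
  topDP := by simp
  bottomDP := by simp

section

variable {base : Word} {ids : TupleIds} {S : Schema} {K : ConstraintSet S} {I : DBInstance S}

/-- The only reserved predicates of the mapping without its violation triple are `rdf:type`,
`rdfs:domain` and `rdfs:range`. -/
theorem DMTriple.reserved {x : Node} {v : Vocab} {y : Term}
    (h : DMTriple base ids K I x (IRI.voc v) y) :
    (v = .rdfType ∧ (y = Term.iri (IRI.voc .owlClass) ∨
      y = Term.iri (IRI.voc .owlObjectProperty) ∨ y = Term.iri (IRI.voc .owlDatatypeProperty) ∨
      ∃ R, y = Term.iri (classIRI base R))) ∨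
    ((v = .rdfsDomain ∨ v = .rdfsRange) ∧ ∃ R, y = Term.iri (classIRI base R)) := by
  generalize hp : IRI.voc v = p at h
  cases h with
  | binRef => exact nomatch hp
  | fkRef => exact nomatch hp
  | literal => exact nomatch hp
  | _ => cases hp; simp

theorem DMTriple.pred_ne {x : Node} {p : IRI} {y : Term} (h : DMTriple base ids K I x p y) :
    p ≠ IRI.voc .owlBottomObjectProperty ∧ p ≠ IRI.voc .owlBottomDataProperty := by
  constructor <;> rintro rfl <;> have := h.reserved <;> simp at this

theorem DMTriple.ne_nothing {x : Node} {p : IRI} {y : Term} (h : DMTriple base ids K I x p y) :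
    y ≠ Term.iri (IRI.voc .owlNothing) := by
  rintro rfl
  cases h with
  | binRef _ _ _ _ _ _ _ _ _ _ _ _ _ _ _ _ _ hr => cases hr
  | fkRef _ _ _ _ _ _ _ _ _ _ _ hr => cases hr

theorem fullInterp_isModel {G : Graph}
    (hG : ∀ x p y, (x, p, y) ∈ G → DMTriple base ids K I x p y) : fullInterp.IsModel G := by
  have hv : ∀ x v y, (x, IRI.voc v, y) ∈ G → _ := fun x v y h => (hG _ _ _ h).reserved
  have hcls : ∀ x p c, (x, p, Term.iri c) ∈ G → ∀ d, d ∈ fullInterp.cls c := fun x p c h d hc =>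
    (hG _ _ _ h).ne_nothing (by rw [hc])
  constructor
  case classAssertion => intro x c _ h; exact hcls _ _ _ h _
  case objectAssertion => intro x p y _ h; exact (hG _ _ _ h).pred_ne.1
  case dataAssertion => intro x p y _ h; exact (hG _ _ _ h).pred_ne.2
  case objectDomain => intro p c _ h x y _; exact hcls _ _ _ h _
  case objectRange => intro p c _ h x y _; exact hcls _ _ _ h _
  case dataDomain => intro p c _ h x y _; exact hcls _ _ _ h _
  case sameAs => intro x y h; simpa using hv _ _ _ h
  case differentFrom => intro x y h; simpa using hv _ _ _ h
  case subClassOf => intro x y h; simpa using hv _ _ _ h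
  case equivalentClass => intro x y h; simpa using hv _ _ _ h
  case disjointWith => intro x y h; simpa using hv _ _ _ h
  case complementOf => intro x y h; simpa using hv _ _ _ h
  case functionalObject => intro p _ h; simpa [classIRI] using hv _ _ _ h
  case functionalData => intro p _ h; simpa [classIRI] using hv _ _ _ h
  case inverseFunctional => intro p _ h; simpa [classIRI] using hv _ _ _ h
  case reflexive => intro p _ h; simpa [classIRI] using hv _ _ _ h
  case irreflexive => intro p _ h; simpa [classIRI] using hv _ _ _ h
  case symmetric => intro p _ h; simpa [classIRI] using hv _ _ _ h
  case asymmetric => intro p _ h; simpa [classIRI] using hv _ _ _ h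
  case transitive => intro p _ h; simpa [classIRI] using hv _ _ _ h
  all_goals intro p q _ _ h; simpa using hv _ _ _ h

end

theorem semanticsPreserving_DMpkfk (base : Word) (ids : TupleIds) (a : Word) :
    SemanticsPreserving (DMpkfk base ids a) := by
  intro S K I
  constructor
  · intro hI
    exact ⟨fullInterp, fullInterp_isModel fun x p y h => (mem_DMpkfk_of_models hI).1 h⟩
  · rintro ⟨M, hM⟩
    rw [models_iff_not_violation]
    intro hv
    exact hM.differentFrom (Node.iri (IRI.res a)) (Node.iri (IRI.res a))
      (mem_DMpkfk.2 (Or.inr ⟨hv, rfl, rfl, rfl⟩)) rfl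

theorem not_monotone_of_repair {base : Word} {ids : TupleIds} {a : Word} {S : Schema}
    {K : ConstraintSet S} {I J : DBInstance S} (hIJ : ∀ R ∈ S.rels, I.rows R ⊆ J.rows R)
    (hI : ¬ I.Models K) (hJ : J.Models K) : ¬ Monotone (DMpkfk base ids a) := by
  intro hm
  rw [models_iff_not_violation, not_not] at hI
  have := hm S K I J hIJ (mem_DMpkfk.2 (Or.inr ⟨hI, rfl, rfl, rfl⟩))
  simpa using ((mem_DMpkfk_of_models hJ).1 this).reserved

/-- The schema with two relations `[]` and `[0]`, both with the single attribute `[]`. -/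
def twoRels : Schema where
  rels := {[], [0]}
  att R := if R = [] ∨ R = [0] then {[]} else ∅
  att_nonempty := by simp
  att_out := by simp

/-- The single foreign key from the first relation to the second. -/
def twoRelsFK : ConstraintSet twoRels where
  cs := {.fk [] [[]] [0] [[]]}
  wf := by simp [Constraint.WF, twoRels]
  key_unique := by simp

/-- The instance of `twoRels` in which the first relation holds one tuple, and the second one the
same tuple or, if `b` is false, none. -/
def twoRelsInst (b : Bool) : DBInstance twoRels where
  rows R := {t | (R = [] ∨ (R = [0] ∧ b = true)) ∧ t = fun A => if A = [] then some [] else none}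
  finite R := (Set.finite_singleton (fun A : Name => if A = [] then some [] else none)).subset
    fun t ht => ht.2
  supp := by
    rintro R t ⟨hR, rfl⟩ A hA
    rcases hR with rfl | ⟨rfl, -⟩ <;> simp_all [twoRels]
  rows_out := by
    intro R hR
    simp only [twoRels, Finset.mem_insert, Finset.mem_singleton, not_or] at hR
    simp [hR]

/-- A violated foreign key can be repaired by adding a tuple to the referenced relation, which
removes the triple that signals the violation. -/
theorem not_monotone_DMpkfk (base : Word) (ids : TupleIds) (a : Word) :
    ¬ Monotone (DMpkfk base ids a) := by
  refine not_monotone_of_repair (K := twoRelsFK) (I := twoRelsInst false)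
    (J := twoRelsInst true) ?_ ?_ ?_
  · rintro R - t ⟨h, rfl⟩
    exact ⟨by simpa using Or.inl h, rfl⟩
  · intro h
    have := (h (.fk [] [[]] [0] [[]]) (by simp [twoRelsFK])).2
      (fun A => if A = [] then some [] else none) ⟨Or.inl rfl, rfl⟩
    simp [twoRelsInst] at this
  · intro c hc
    simp only [twoRelsFK, Finset.mem_singleton] at hc
    subst hc
    simp [DBInstance.Sat, DBInstance.SatKey, twoRelsInst]

/-! ### Mappings that represent tuples -/

section Mappings

/-- The mapping of a tuple whose attribute `A` is represented by the variable `ρ A`. -/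
def renamedTr (ρ : Equiv.Perm Name) (t : Tuple) : Mapping := fun x => tr t (ρ.symm x)

/-- Compatibility of tuples, nulls being compatible with everything. -/
def TupleCompat (t₁ t₂ : Tuple) : Prop := ∀ A, t₁ A ≠ none → t₂ A ≠ none → t₁ A = t₂ A

/-- The values of the first tuple, with the nulls filled from the second one. -/
def tupleUnion (t₁ t₂ : Tuple) : Tuple := fun A => (t₁ A).or (t₂ A)

variable (ρ : Equiv.Perm Name)

@[simp] theorem renamedTr_eq_none {t : Tuple} {x : Var} :
    renamedTr ρ t x = none ↔ t (ρ.symm x) = none := by simp [renamedTr, tr]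

theorem renamedTr_apply (t : Tuple) (A : Name) :
    renamedTr ρ t (ρ A) = (t A).map Term.lit := by simp [renamedTr, tr]

theorem renamedTr_eq_iff {t₁ t₂ : Tuple} {x : Var} :
    renamedTr ρ t₁ x = renamedTr ρ t₂ x ↔ t₁ (ρ.symm x) = t₂ (ρ.symm x) := by
  have : Function.Injective (Term.lit) := Sum.inr_injective
  exact (Option.map_injective this).eq_iff

theorem renamedTr_compat {t₁ t₂ : Tuple} :
    (renamedTr ρ t₁).Compat (renamedTr ρ t₂) ↔ TupleCompat t₁ t₂ := by
  simp only [Mapping.Compat, Mapping.dom, TupleCompat, Set.mem_inter_iff, Set.mem_ofPred_eq, ne_eq,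
    renamedTr_eq_none, renamedTr_eq_iff, and_imp]
  exact ⟨fun h A => by simpa using h (ρ A), fun h x => h (ρ.symm x)⟩

theorem renamedTr_union (t₁ t₂ : Tuple) :
    (renamedTr ρ t₁).union (renamedTr ρ t₂) = renamedTr ρ (tupleUnion t₁ t₂) := by
  funext x
  simp only [Mapping.union, renamedTr_eq_none]
  simp only [renamedTr, tr, tupleUnion]
  cases t₁ (ρ.symm x) <;> simp

theorem rename_nil (μ : Mapping) : Mapping.rename [] μ = μ := by
  funext x; simp [Mapping.rename]

/-- The mapping defined only at `X`. -/
def single (X : Var) (y : Term) : Mapping := fun z => if z = X then some y else none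

/-- The mapping defined only at `X` and `Y`. -/
def double (X : Var) (x : Term) (Y : Var) (y : Term) : Mapping :=
  fun z => if z = X then some x else if z = Y then some y else none

theorem mem_eval_triple_var_const {G : Graph} {X : Var} {p : IRI} {o : TermPat} {y : Term}
    (ho : o.vars = ∅) (hy : ∀ μ, o.app μ = some y) {μ : Mapping} :
    μ ∈ (Pattern.triple (.var X) (.iri p) o).eval G ↔
      ∃ x, (x, p, y) ∈ G ∧ μ = single X (Term.node x) := by
  simp only [Pattern.eval, ho, hy, Set.mem_ofPred_eq, Option.some.injEq]
  simp only [TermPat.vars, PredPat.vars, Set.union_empty, TermPat.app, PredPat.app,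
    Option.some.injEq]
  constructor
  · rintro ⟨hd, ⟨x, q, z⟩, hg, hX, hp, rfl⟩
    obtain rfl : p = q := by simpa using hp
    refine ⟨x, hg, funext fun w => ?_⟩
    by_cases hw : w = X
    · subst hw; simpa [single] using hX
    · have : w ∉ μ.dom := by simp [hd, hw]
      simpa [single, hw, Mapping.dom] using this
  · rintro ⟨x, hg, rfl⟩
    refine ⟨?_, _, hg, by simp [single], rfl, rfl⟩
    ext w; simp [Mapping.dom, single]

theorem mem_eval_triple_var_var {G : Graph} {X Y : Var} (hXY : X ≠ Y) {p : IRI} {μ : Mapping} :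
    μ ∈ (Pattern.triple (.var X) (.iri p) (.var Y)).eval G ↔
      ∃ x y, (x, p, y) ∈ G ∧ μ = double X (Term.node x) Y y := by
  simp only [Pattern.eval, TermPat.vars, PredPat.vars, Set.union_empty, TermPat.app,
    PredPat.app, Set.mem_ofPred_eq, Option.some.injEq]
  constructor
  · rintro ⟨hd, ⟨x, q, z⟩, hg, hX, hp, hY⟩
    obtain rfl : p = q := by simpa using hp
    refine ⟨x, z, hg, funext fun w => ?_⟩
    by_cases hw : w = X
    · subst hw; simpa [double] using hX
    · by_cases hw' : w = Y
      · subst hw'; simpa [double, hw] using hY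
      · have : w ∉ μ.dom := by simp [hd, hw, hw']
        simpa [double, hw, hw', Mapping.dom] using this
  · rintro ⟨x, y, hg, rfl⟩
    refine ⟨?_, _, hg, by simp [double], rfl, by simp [double, hXY.symm]⟩
    ext w
    by_cases hw : w = X
    · simp [Mapping.dom, double, hw]
    · by_cases hw' : w = Y <;> simp [Mapping.dom, double, hw, hw']
      simp [hXY.symm]

theorem mem_eval_select_nil {G : Graph} {keep : List Var} {P : Pattern} {μ : Mapping} :
    μ ∈ (Pattern.select [] keep P).eval G ↔ ∃ μ' ∈ P.eval G, μ = μ'.restrict keep := by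
  simp [Pattern.eval, rename_nil]

/-- A permutation that moves `B` away from `F` and fixes the rest of `F`. -/
theorem exists_perm_avoiding (B F : Finset Name) : ∃ σ : Equiv.Perm Name,
    (∀ x ∈ B, σ x ∉ F) ∧ ∀ x ∈ F, x ∉ B → σ x = x := by
  induction B using Finset.induction_on generalizing F with
  | empty => exact ⟨Equiv.refl _, by simp⟩
  | insert b B hb ih =>
    obtain ⟨σ, h1, h2⟩ := ih (insert b F)
    obtain ⟨c, hc⟩ := Infinite.exists_notMem_finset (insert b F ∪ B.image σ)
    simp only [Finset.mem_union, Finset.mem_insert, Finset.mem_image, not_or, not_exists,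
      not_and] at hc h1 h2
    refine ⟨σ.trans (Equiv.swap b c), fun x hx => ?_, fun x hx hxB => ?_⟩
    · rcases Finset.mem_insert.1 hx with rfl | hx
      · simpa [h2 x (Or.inl rfl) hb] using hc.1.2
      · have h3 := h1 x hx
        have h4 := hc.2 x hx
        simpa [Equiv.swap_apply_of_ne_of_ne h3.1 h4] using h3.2
    · simp only [Finset.mem_insert, not_or] at hxB
      have hxc : x ≠ c := fun h => hc.1.2 (h ▸ hx)
      simp [h2 x (Or.inr hx) hxB.2, Equiv.swap_apply_of_ne_of_ne hxB.1 hxc]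

end Mappings

/-! ### Translatable families of sets of tuples -/

section Translatable

variable (base : Word) (ids : TupleIds) (a : Word) {S : Schema} (K : ConstraintSet S)

/-- The sets `f I` of tuples over the attributes `U` are the answers of a graph pattern over the
graphs of the legal instances `I`. The variables that represent the attributes can be chosen
(`ρ`), and the other variables of the pattern, collected in `H`, can be kept away from any finite
set `F`; the pattern is non-parametric in every context that does not use `H`. This freedom is
what renaming, projection and the combination of two patterns require. -/
def Translatable (U : Finset Name) (f : DBInstance S → Set Tuple) : Prop :=
  ∀ (ρ : Equiv.Perm Name) (F : Finset Name), ∃ (P : Pattern) (H : Finset Name), P.WF ∧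
    (∀ x ∈ P.vars, x ∈ U.image ρ ∨ x ∈ H) ∧ (∀ x ∈ H, x ∉ F) ∧
    (∀ X : Set Var, (∀ x ∈ X, x ∉ H) → P.NonParamIn X) ∧
    ∀ I : DBInstance S, I.Models K →
      P.eval (DMpkfk base ids a S K I) = renamedTr ρ '' f I

variable {base ids a K} {U U₁ U₂ : Finset Name} {f g f₁ f₂ : DBInstance S → Set Tuple}

theorem Translatable.congr (hf : Translatable base ids a K U f)
    (h : ∀ I : DBInstance S, I.Models K → f I = g I) : Translatable base ids a K U g := by
  intro ρ F
  obtain ⟨P, H, h1, h2, h3, h4, h5⟩ := hf ρ F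
  exact ⟨P, H, h1, h2, h3, h4, fun I hI => by rw [h5 I hI, h I hI]⟩

theorem Translatable.mono (hf : Translatable base ids a K U₁ f) (h : U₁ ⊆ U₂) :
    Translatable base ids a K U₂ f := by
  intro ρ F
  obtain ⟨P, H, h1, h2, h3, h4, h5⟩ := hf ρ F
  exact ⟨P, H, h1, fun x hx => (h2 x hx).imp_left fun hx => Finset.image_subset_image h hx,
    h3, h4, h5⟩

/-- Patterns for two families of sets, with the hidden variables of each kept away from the
variables of the other. -/
theorem Translatable.pair (hf : Translatable base ids a K U₁ f₁)
    (hg : Translatable base ids a K U₂ f₂) (ρ : Equiv.Perm Name) (F : Finset Name) :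
    ∃ (P₁ P₂ : Pattern) (H : Finset Name), P₁.WF ∧ P₂.WF ∧
      (∀ x ∈ P₁.vars, x ∈ (U₁ ∪ U₂).image ρ ∨ x ∈ H) ∧
      (∀ x ∈ P₂.vars, x ∈ (U₁ ∪ U₂).image ρ ∨ x ∈ H) ∧ (∀ x ∈ H, x ∉ F) ∧
      (∀ X : Set Var, (∀ x ∈ X, x ∉ H) → P₁.NonParamIn (X ∪ P₂.vars) ∧
        P₂.NonParamIn (X ∪ P₁.vars)) ∧
      ∀ I : DBInstance S, I.Models K →
        P₁.eval (DMpkfk base ids a S K I) = renamedTr ρ '' f₁ I ∧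
        P₂.eval (DMpkfk base ids a S K I) = renamedTr ρ '' f₂ I := by
  obtain ⟨P₁, H₁, h1, h2, h3, h4, h5⟩ := hf ρ (F ∪ (U₁ ∪ U₂).image ρ)
  obtain ⟨P₂, H₂, k1, k2, k3, k4, k5⟩ := hg ρ (F ∪ (U₁ ∪ U₂).image ρ ∪ H₁)
  simp only [Finset.mem_union, not_or] at h3 k3
  have s1 : ∀ x ∈ U₁.image ρ, x ∈ (U₁ ∪ U₂).image ρ := fun x hx =>
    Finset.image_subset_image Finset.subset_union_left hx
  have s2 : ∀ x ∈ U₂.image ρ, x ∈ (U₁ ∪ U₂).image ρ := fun x hx =>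
    Finset.image_subset_image Finset.subset_union_right hx
  refine ⟨P₁, P₂, H₁ ∪ H₂, h1, k1, fun x hx => ?_, fun x hx => ?_, fun x hx => ?_,
    fun X hX => ⟨h4 _ fun x hx hH => ?_, k4 _ fun x hx hH => ?_⟩, fun I hI => ⟨h5 I hI, k5 I hI⟩⟩
  · exact (h2 x hx).imp (s1 x) fun h => Finset.mem_union_left _ h
  · exact (k2 x hx).imp (s2 x) fun h => Finset.mem_union_right _ h
  · exact (Finset.mem_union.1 hx).elim (fun h => (h3 x h).1) fun h => (k3 x h).1.1
  · rcases hx with hx | hx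
    · exact hX x hx (Finset.mem_union_left _ hH)
    · exact (k2 x hx).elim (fun h => (h3 x hH).2 (s2 x h)) fun h => (k3 x h).2 hH
  · rcases hx with hx | hx
    · exact hX x hx (Finset.mem_union_right _ hH)
    · exact (h2 x hx).elim (fun h => (k3 x hH).1.2 (s1 x h)) fun h => (k3 x hH).2 h

theorem Translatable.union (hf : Translatable base ids a K U₁ f₁)
    (hg : Translatable base ids a K U₂ f₂) :
    Translatable base ids a K (U₁ ∪ U₂) (fun I => f₁ I ∪ f₂ I) := by
  intro ρ F
  obtain ⟨P₁, P₂, H, h1, h2, h3, h4, h5, h6, h7⟩ := hf.pair hg ρ F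
  refine ⟨.union P₁ P₂, H, ⟨h1, h2⟩, fun x hx => hx.elim (h3 x) (h4 x), h5, h6, fun I hI => ?_⟩
  rw [Pattern.eval, (h7 I hI).1, (h7 I hI).2, Set.image_union]

/-- The pattern matches no triple, since no generated triple has a reserved class as predicate. -/
theorem translatable_empty : Translatable base ids a K ∅ (fun _ => ∅) := by
  intro ρ F
  refine ⟨.triple (.iri (IRI.voc .owlThing)) (.iri (IRI.voc .owlThing))
    (.iri (IRI.voc .owlThing)), ∅, trivial, ?_, by simp, fun _ _ => trivial, fun I hI => ?_⟩
  · simp [Pattern.vars, TermPat.vars, PredPat.vars]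
  · rw [Set.image_empty, Set.eq_empty_iff_forall_notMem]
    rintro μ ⟨-, ⟨x, p, y⟩, hg, -, hp, -⟩
    obtain rfl : IRI.voc .owlThing = p := by simpa [PredPat.app] using hp
    simpa using ((mem_DMpkfk_of_models hI).1 hg).reserved

theorem Translatable.iUnion {ι : Type*} (l : List ι) {f : ι → DBInstance S → Set Tuple}
    (h : ∀ i ∈ l, Translatable base ids a K U (f i)) :
    Translatable base ids a K U (fun I => {t | ∃ i ∈ l, t ∈ f i I}) := by
  induction l with
  | nil => exact (translatable_empty.mono (Finset.empty_subset U)).congr fun I _ => by simp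
  | cons i l ih =>
    have := (h i (by simp)).union (ih fun j hj => h j (by simp [hj]))
    rw [Finset.union_self] at this
    exact this.congr fun I _ => by ext; simp

theorem DMpkfk_nonempty (hS : S.rels.Nonempty) {I : DBInstance S} :
    (DMpkfk base ids a S K I).Nonempty := by
  obtain ⟨R, hR⟩ := exists_isClass (K := K) hS
  exact ⟨(_, _, _), mem_DMpkfk.2 (Or.inl (.cls R hR))⟩

theorem translatable_null (hS : S.rels.Nonempty) :
    Translatable base ids a K ∅ (fun _ => {fun _ => none}) := by
  intro ρ F
  refine ⟨.empty, ∅, trivial, by simp [Pattern.vars], by simp, fun _ _ => trivial, fun I hI => ?_⟩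
  rw [Set.image_singleton]
  ext μ
  simp only [Pattern.eval, DMpkfk_nonempty hS, true_and, Set.mem_ofPred_eq, Set.mem_singleton_iff]
  rfl

theorem Translatable.filter (hf : Translatable base ids a K U f) {A : Name} (hA : A ∈ U)
    (c : Var → Cond) (hc : ∀ x, (c x).vars = {x}) (p : Tuple → Prop)
    (hp : ∀ (ρ : Equiv.Perm Name) t, (c (ρ A)).Holds (renamedTr ρ t) ↔ p t) :
    Translatable base ids a K U (fun I => {t ∈ f I | p t}) := by
  intro ρ F
  obtain ⟨P, H, h1, h2, h3, h4, h5⟩ := hf ρ (F ∪ U.image ρ)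
  have hA' : ρ A ∈ U.image ρ := Finset.mem_image_of_mem _ hA
  refine ⟨.filter P (c (ρ A)), H, h1, ?_, fun x hx hF => h3 x hx (by simp [hF]), ?_,
    fun I hI => ?_⟩
  · rintro x (hx | hx)
    · exact h2 x hx
    · rw [hc] at hx
      exact Or.inl (hx ▸ hA')
  · intro X hX
    refine h4 _ ?_
    rintro x (hx | hx) hH
    · exact hX x hx hH
    · rw [hc] at hx
      exact h3 x hH (Finset.mem_union_right _ (hx ▸ hA'))
  · rw [Pattern.eval, h5 I hI]
    ext μ
    constructor
    · rintro ⟨⟨t, ht, rfl⟩, hh⟩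
      exact ⟨t, ⟨ht, (hp ρ t).1 hh⟩, rfl⟩
    · rintro ⟨t, ⟨ht, hh⟩, rfl⟩
      exact ⟨⟨t, ht, rfl⟩, (hp ρ t).2 hh⟩

theorem Translatable.notNull (hf : Translatable base ids a K U f) {A : Name} (hA : A ∈ U) :
    Translatable base ids a K U (fun I => {t ∈ f I | t A ≠ none}) :=
  hf.filter hA .bound (fun _ => rfl) _ fun ρ t => by
    simp [Cond.Holds, Mapping.dom]

theorem Translatable.isNull (hf : Translatable base ids a K U f) {A : Name} (hA : A ∈ U) :
    Translatable base ids a K U (fun I => {t ∈ f I | t A = none}) :=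
  hf.filter hA (fun x => .not (.bound x)) (fun _ => rfl) _ fun ρ t => by
    simp [Cond.Holds, Mapping.dom]

theorem Translatable.notNull_list (hf : Translatable base ids a K U f) (l : List Name)
    (hl : ∀ A ∈ l, A ∈ U) :
    Translatable base ids a K U (fun I => {t ∈ f I | ∀ A ∈ l, t A ≠ none}) := by
  induction l with
  | nil => simpa using hf
  | cons A l ih =>
    refine ((ih fun B hB => hl B (by simp [hB])).notNull (hl A (by simp))).congr fun I _ => ?_
    ext t
    simp only [Set.mem_ofPred_eq, List.forall_mem_cons]
    tauto

/-- SPARQL's AND combines compatible tuples. -/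
theorem Translatable.combine (hf : Translatable base ids a K U₁ f₁)
    (hg : Translatable base ids a K U₂ f₂) :
    Translatable base ids a K (U₁ ∪ U₂) (fun I => {t | ∃ t₁ ∈ f₁ I, ∃ t₂ ∈ f₂ I,
      TupleCompat t₁ t₂ ∧ t = tupleUnion t₁ t₂}) := by
  intro ρ F
  obtain ⟨P₁, P₂, H, h1, h2, h3, h4, h5, h6, h7⟩ := hf.pair hg ρ F
  refine ⟨.and P₁ P₂, H, ⟨h1, h2⟩, fun x hx => hx.elim (h3 x) (h4 x), h5, h6, fun I hI => ?_⟩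
  rw [Pattern.eval, (h7 I hI).1, (h7 I hI).2]
  ext μ
  constructor
  · rintro ⟨_, ⟨t₁, ht₁, rfl⟩, _, ⟨t₂, ht₂, rfl⟩, hc, rfl⟩
    exact ⟨_, ⟨t₁, ht₁, t₂, ht₂, (renamedTr_compat ρ).1 hc, rfl⟩, (renamedTr_union ρ _ _).symm⟩
  · rintro ⟨_, ⟨t₁, ht₁, t₂, ht₂, hc, rfl⟩, rfl⟩
    exact ⟨_, ⟨t₁, ht₁, rfl⟩, _, ⟨t₂, ht₂, rfl⟩, (renamedTr_compat ρ).2 hc,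
      (renamedTr_union ρ _ _).symm⟩

/-- The tuples of the first set that are compatible with no tuple of the second one. MINUS does
not express this, as it ignores mappings with disjoint domains. Instead, a variable that OPT binds
whenever there is a compatible tuple is required to be unbound; it ranges over the classes, of
which there is at least one. -/
theorem Translatable.antijoin (hS : S.rels.Nonempty) (hf : Translatable base ids a K U₁ f₁)
    (hg : Translatable base ids a K U₂ f₂) (hf₁ : ∀ I, ∀ t ∈ f₁ I, ∀ A, A ∉ U₁ → t A = none)
    (hf₂ : ∀ I, ∀ t ∈ f₂ I, ∀ A, A ∉ U₂ → t A = none) :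
    Translatable base ids a K (U₁ ∪ U₂) (fun I => {t ∈ f₁ I | ∀ t₂ ∈ f₂ I,
      ¬ TupleCompat t t₂}) := by
  intro ρ F
  obtain ⟨P₁, P₂, H, h1, h2, h3, h4, h5, h6, h7⟩ := hf.pair hg ρ F
  obtain ⟨X, hX⟩ := Infinite.exists_notMem_finset (F ∪ H ∪ (U₁ ∪ U₂).image ρ)
  simp only [Finset.mem_union, not_or] at hX
  obtain ⟨⟨hXF, hXH⟩, hXU⟩ := hX
  let T : Pattern := .triple (.var X) (.iri (IRI.voc .rdfType)) (.iri (IRI.voc .owlClass))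
  have hT : T.vars = {X} := by simp [T, Pattern.vars, TermPat.vars, PredPat.vars]
  refine ⟨.filter (.opt P₁ (.and P₂ T)) (.not (.bound X)), insert X H, ⟨h1, h2, trivial⟩,
    ?_, ?_, ?_, fun I hI => ?_⟩
  · simp only [Pattern.vars, hT, Cond.vars]
    rintro x ((hx | hx | hx) | hx)
    · exact (h3 x hx).imp_right Finset.mem_insert_of_mem
    · exact (h4 x hx).imp_right Finset.mem_insert_of_mem
    · exact Or.inr (hx ▸ Finset.mem_insert_self X H)
    · exact Or.inr (hx ▸ Finset.mem_insert_self X H)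
  · intro x hx
    rcases Finset.mem_insert.1 hx with rfl | hx
    exacts [hXF, h5 x hx]
  · intro Y hY
    have hY' : ∀ x ∈ Y ∪ {X}, x ∉ H := by
      rintro x (hx | rfl) hH
      exacts [hY x hx (Finset.mem_insert_of_mem hH), hXH hH]
    have := h6 _ hY'
    refine ⟨?_, ?_, trivial⟩
    · have e : Y ∪ {X} ∪ P₂.vars = Y ∪ {X} ∪ (P₂.vars ∪ {X}) := by
        ext; simp only [Set.mem_union]; tauto
      simpa only [Pattern.vars, hT, Cond.vars, ← e] using this.1
    · have e : Y ∪ {X} ∪ P₁.vars = Y ∪ {X} ∪ P₁.vars ∪ {X} := by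
        ext; simp only [Set.mem_union]; tauto
      simpa only [Pattern.vars, hT, Cond.vars, ← e] using this.2
  · have hXt : ∀ {U : Finset Name} {t : Tuple}, U ⊆ U₁ ∪ U₂ → (∀ A, A ∉ U → t A = none) →
        renamedTr ρ t X = none := by
      intro U t hU ht
      rw [renamedTr_eq_none]
      exact ht _ fun h => hXU (Finset.mem_image.2 ⟨_, hU h, by simp⟩)
    have hX₁ := fun t ht => hXt Finset.subset_union_left (hf₁ I t ht)
    have hX₂ := fun t ht => hXt Finset.subset_union_right (hf₂ I t ht)
    -- Since `X` is unbound in the answers of `P₁`, joining `P₂` with `T` does not change which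
    -- answers are compatible.
    have hun : ∀ (t₂ : Tuple) (c : Term) (y : Var), y ≠ X →
        (renamedTr ρ t₂).union (single X c) y = renamedTr ρ t₂ y := by
      intro t₂ c y hy
      by_cases h : renamedTr ρ t₂ y = none <;> simp [Mapping.union, single, hy, h]
    have hcomp : ∀ t ∈ f₁ I, ∀ (t₂ : Tuple) (c : Term),
        (renamedTr ρ t).Compat ((renamedTr ρ t₂).union (single X c)) ↔ TupleCompat t t₂ := by
      intro t ht t₂ c
      rw [← renamedTr_compat ρ]
      have key : ∀ y, renamedTr ρ t y ≠ none → y ≠ X := fun y hy h => hy (h ▸ hX₁ t ht)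
      simp only [Mapping.Compat, Mapping.dom, Set.mem_inter_iff, Set.mem_ofPred_eq, and_imp]
      refine forall_congr' fun y => ?_
      refine forall_congr' fun hy => ?_
      rw [hun t₂ c y (key y hy)]
    have hand : ∀ μ, μ ∈ (Pattern.and P₂ T).eval (DMpkfk base ids a S K I) ↔
        ∃ t₂ ∈ f₂ I, ∃ R, IsClass K R ∧
          μ = (renamedTr ρ t₂).union (single X (Term.iri (classIRI base R))) := by
      intro μ
      have hTe := @mem_eval_triple_var_const (DMpkfk base ids a S K I) X (IRI.voc .rdfType)
        (.iri (IRI.voc .owlClass)) (Term.iri (IRI.voc .owlClass)) rfl fun _ => rfl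
      rw [Pattern.eval, (h7 I hI).2]
      constructor
      · rintro ⟨_, ⟨t₂, ht₂, rfl⟩, _, hτ, hc, rfl⟩
        obtain ⟨x, hx, rfl⟩ := hTe.1 hτ
        obtain ⟨R, hR, rfl⟩ := dmTriple_type_owlClass.1 ((mem_DMpkfk_of_models hI).1 hx)
        exact ⟨t₂, ht₂, R, hR, rfl⟩
      · rintro ⟨t₂, ht₂, R, hR, rfl⟩
        refine ⟨_, ⟨t₂, ht₂, rfl⟩, _, hTe.2 ⟨_, mem_DMpkfk.2 (Or.inl (.cls R hR)), rfl⟩, ?_, rfl⟩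
        rintro y ⟨hy₁, hy₂⟩
        by_cases hyX : y = X
        · subst hyX
          exact absurd (hX₂ t₂ ht₂) hy₁
        · simp [Mapping.dom, single, hyX] at hy₂
    obtain ⟨R, hR⟩ := exists_isClass (K := K) hS
    ext μ
    simp only [Pattern.eval, Cond.Holds, Mapping.dom, Set.mem_ofPred_eq, not_not]
    constructor
    · rintro ⟨⟨μ₁, -, μ₂, hμ₂, -, rfl⟩ | ⟨hμ, hno⟩, hb⟩
      · obtain ⟨t₂, ht₂, R, -, rfl⟩ := (hand μ₂).1 hμ₂
        exfalso
        simp only [Mapping.union, single] at hb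
        split_ifs at hb <;> simp_all
      · rw [(h7 I hI).1] at hμ
        obtain ⟨t, ht, rfl⟩ := hμ
        refine ⟨t, ⟨ht, fun t₂ ht₂ hc => ?_⟩, rfl⟩
        exact hno _ ((hand _).2 ⟨t₂, ht₂, R, hR, rfl⟩) ((hcomp t ht t₂ _).2 hc)
    · rintro ⟨t, ⟨ht, hno⟩, rfl⟩
      refine ⟨Or.inr ⟨?_, ?_⟩, hX₁ t ht⟩
      · rw [(h7 I hI).1]
        exact ⟨t, ht, rfl⟩
      · intro μ' hμ' hc
        obtain ⟨t₂, ht₂, R, -, rfl⟩ := (hand μ').1 hμ'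
        exact hno t₂ ht₂ ((hcomp t ht t₂ _).1 hc)

/-- Difference. For tuples that are null in the same attributes, being compatible means being
equal; the general case reduces to this one by splitting both sets on the nullness of one
attribute after the other. -/
theorem Translatable.diff (hS : S.rels.Nonempty) (hf : Translatable base ids a K U f)
    (hg : Translatable base ids a K U g) (hfs : ∀ I, ∀ t ∈ f I, ∀ A, A ∉ U → t A = none)
    (hgs : ∀ I, ∀ t ∈ g I, ∀ A, A ∉ U → t A = none) :
    Translatable base ids a K U (fun I => f I \ g I) := by
  suffices h : ∀ (l : List Name) (f g : DBInstance S → Set Tuple), (∀ A ∈ l, A ∈ U) →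
      Translatable base ids a K U f → Translatable base ids a K U g →
      (∀ I, ∀ t ∈ f I, ∀ A, A ∉ U → t A = none) → (∀ I, ∀ t ∈ g I, ∀ A, A ∉ U → t A = none) →
      (∀ A ∈ U, A ∉ l → (∀ I, ∀ t ∈ f I ∪ g I, t A = none) ∨
        ∀ I, ∀ t ∈ f I ∪ g I, t A ≠ none) →
      Translatable base ids a K U (fun I => f I \ g I) from
    h U.toList f g (by simp) hf hg hfs hgs fun A hA hn => absurd (Finset.mem_toList.2 hA) hn
  clear! f g
  intro l
  induction l with
  | nil =>
    intro f g _ hf hg hfs hgs hsame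
    have := hf.antijoin hS hg hfs hgs
    rw [Finset.union_self] at this
    refine this.congr fun I _ => ?_
    have key : ∀ t ∈ f I, ∀ t₂ ∈ g I, TupleCompat t t₂ ↔ t = t₂ := by
      intro t ht t₂ ht₂
      refine ⟨fun h => funext fun A => ?_, fun h A _ _ => h ▸ rfl⟩
      by_cases hA : A ∈ U
      · rcases hsame A hA (by simp) with hn | hn
        · rw [hn I t (Or.inl ht), hn I t₂ (Or.inr ht₂)]
        · exact h A (hn I t (Or.inl ht)) (hn I t₂ (Or.inr ht₂))
      · rw [hfs I t ht A hA, hgs I t₂ ht₂ A hA]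
    ext t
    constructor
    · rintro ⟨ht, h⟩
      exact ⟨ht, fun htg => h t htg ((key t ht t htg).2 rfl)⟩
    · rintro ⟨ht, h⟩
      exact ⟨ht, fun t₂ ht₂ hc => h ((key t ht t₂ ht₂).1 hc ▸ ht₂)⟩
  | cons A l ih =>
    intro f g hl hf hg hfs hgs hsame
    have hA := hl A (by simp)
    have hl' : ∀ B ∈ l, B ∈ U := fun B hB => hl B (by simp [hB])
    have h1 := ih _ _ hl' (hf.isNull hA) (hg.isNull hA) (fun I t ht => hfs I t ht.1)
      (fun I t ht => hgs I t ht.1) ?_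
    have h2 := ih _ _ hl' (hf.notNull hA) (hg.notNull hA) (fun I t ht => hfs I t ht.1)
      (fun I t ht => hgs I t ht.1) ?_
    · have := h1.union h2
      rw [Finset.union_self] at this
      refine this.congr fun I _ => ?_
      ext t
      simp only [Set.mem_union, Set.mem_sdiff, Set.mem_ofPred_eq]
      tauto
    all_goals
      intro B hB hBl
      by_cases hBA : B = A
      · subst hBA
        first
          | exact Or.inl fun I t ht => ht.elim (fun h => h.2) fun h => h.2
          | exact Or.inr fun I t ht => ht.elim (fun h => h.2) fun h => h.2
      · refine (hsame B hB (by simp [hBA, hBl])).imp (fun h I t ht => h I t ?_)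
          (fun h I t ht => h I t ?_) <;> exact ht.imp (fun h => h.1) fun h => h.1

/-- The restriction of a tuple to a set of attributes. -/
def restrictTuple (U : Finset Name) (t : Tuple) : Tuple := fun A => if A ∈ U then t A else none

/-- Projection. The attributes that are projected out are first represented by fresh variables,
which makes the SELECT clause non-parametric. -/
theorem Translatable.proj (hf : Translatable base ids a K U f) (V : Finset Name) :
    Translatable base ids a K V (fun I => restrictTuple V '' f I) := by
  intro ρ F
  obtain ⟨σ, hσ₁, hσ₂⟩ := exists_perm_avoiding ((U \ V).image ρ) (F ∪ V.image ρ)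
  have hρ : ∀ A ∈ V, (ρ.trans σ) A = ρ A := by
    intro A hA
    refine hσ₂ _ (Finset.mem_union_right _ (Finset.mem_image_of_mem _ hA)) ?_
    simp [hA]
  obtain ⟨P, H, h1, h2, h3, h4, h5⟩ := hf (ρ.trans σ) (F ∪ V.image ρ)
  refine ⟨.select [] (V.image ρ).toList P, H ∪ (U \ V).image (ρ.trans σ), ⟨h1, ?_, by simp⟩,
    ?_, ?_, ?_, fun I hI => ?_⟩
  · simpa using Finset.nodup_toList _
  · have hvars : ∀ x ∈ P.vars, x ∈ V.image ρ ∨ x ∈ H ∪ (U \ V).image (ρ.trans σ) := by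
      intro x hx
      rcases h2 x hx with hx | hx
      · obtain ⟨A, hA, rfl⟩ := Finset.mem_image.1 hx
        by_cases hAV : A ∈ V
        · rw [hρ A hAV]
          exact Or.inl (Finset.mem_image_of_mem _ hAV)
        · exact Or.inr (Finset.mem_union_right _
            (Finset.mem_image_of_mem _ (Finset.mem_sdiff.2 ⟨hA, hAV⟩)))
      · exact Or.inr (Finset.mem_union_left _ hx)
    rintro x (hx | hx)
    · simp only [selectVars, List.map_nil, List.not_mem_nil, Finset.mem_toList, false_or,
        Set.mem_ofPred_eq] at hx
      exact Or.inl hx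
    · exact hvars x hx
  · intro x hx hF
    rcases Finset.mem_union.1 hx with hx | hx
    · exact h3 x hx (Finset.mem_union_left _ hF)
    · obtain ⟨A, hA, rfl⟩ := Finset.mem_image.1 hx
      exact hσ₁ (ρ A) (Finset.mem_image_of_mem _ hA) (Finset.mem_union_left _ hF)
  · intro X hX
    refine ⟨fun x hx _ hk hxX => hX x hxX ?_, h4 _ ?_⟩
    · rcases h2 x hx with hx | hx
      · obtain ⟨A, hA, rfl⟩ := Finset.mem_image.1 hx
        refine Finset.mem_union_right _ (Finset.mem_image_of_mem _ (Finset.mem_sdiff.2 ⟨hA, ?_⟩))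
        intro hAV
        rw [hρ A hAV] at hk
        exact hk (Finset.mem_toList.2 (Finset.mem_image_of_mem _ hAV))
      · exact Finset.mem_union_left _ hx
    · rintro x (hx | hx) hH
      · exact hX x hx (Finset.mem_union_left _ hH)
      · simp only [selectVars, List.map_nil, List.not_mem_nil, Finset.mem_toList, false_or,
          Set.mem_ofPred_eq] at hx
        exact h3 x hH (Finset.mem_union_right _ hx)
  · have key : ∀ t, (renamedTr (ρ.trans σ) t).restrict (V.image ρ).toList =
        renamedTr ρ (restrictTuple V t) := by
      intro t
      funext x
      obtain ⟨A, rfl⟩ := ρ.surjective x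
      rw [renamedTr_apply]
      by_cases hA : A ∈ V
      · have := renamedTr_apply (ρ.trans σ) t A
        rw [hρ A hA] at this
        simp [Mapping.restrict, restrictTuple, hA, this]
      · simp [Mapping.restrict, restrictTuple, hA]
    ext μ
    rw [mem_eval_select_nil, h5 I hI]
    constructor
    · rintro ⟨_, ⟨t, ht, rfl⟩, rfl⟩
      exact ⟨_, ⟨t, ht, rfl⟩, (key t).symm⟩
    · rintro ⟨_, ⟨t, ht, rfl⟩, rfl⟩
      exact ⟨_, ⟨t, ht, rfl⟩, (key t).symm⟩

/-- Renaming costs nothing: it changes the choice of the variables. -/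
theorem Translatable.perm (hf : Translatable base ids a K U f) (τ : Equiv.Perm Name) :
    Translatable base ids a K (U.image τ) (fun I => (fun t A => t (τ.symm A)) '' f I) := by
  intro ρ F
  obtain ⟨P, H, h1, h2, h3, h4, h5⟩ := hf (τ.trans ρ) F
  refine ⟨P, H, h1, fun x hx => ?_, h3, h4, fun I hI => ?_⟩
  · rw [Finset.image_image]
    exact h2 x hx
  · rw [h5 I hI, Set.image_image]
    rfl

end Translatable

/-! ### Patterns for constants and for the relations of the schema -/

section Relations

variable {base : Word} {ids : TupleIds} {a : Word} {S : Schema} {K : ConstraintSet S}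

/-- The tuple with the single value `v`, in the attribute `A`. -/
def constTuple (A : Name) (v : Val) : Tuple := fun B => if B = A then some v else none

theorem translatable_column {C R : Name} (hC : DataP K C R) (A : Name) (v : Val) :
    Translatable base ids a K {A} (fun I => {t | t = constTuple A v ∧
      ∃ s ∈ I.rows R, s C = some v}) := by
  intro ρ F
  obtain ⟨X, hX⟩ := Infinite.exists_notMem_finset (insert (ρ A) F)
  simp only [Finset.mem_insert, not_or] at hX
  obtain ⟨hXA, hXF⟩ := hX
  refine ⟨.select [] [ρ A] (.and (.triple (.var X) (.iri (dataIRI base C R)) (.lit v))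
    (.triple (.var X) (.iri (dataIRI base C R)) (.var (ρ A)))), {X}, ?_, ?_, ?_, ?_,
    fun I hI => ?_⟩
  · simp [Pattern.WF]
  · simp only [Pattern.vars, selectVars, TermPat.vars, PredPat.vars, Finset.image_singleton,
      Finset.mem_singleton]
    rintro x (hx | hx) <;> simp at hx <;> tauto
  · simpa using hXF
  · intro Y hY
    refine ⟨fun x hx _ hk hxY => ?_, trivial, trivial⟩
    have := hY x hxY
    simp [Pattern.vars, TermPat.vars, PredPat.vars] at hx hk this
    tauto
  · have hres : ∀ x : Node, ((single X (Term.node x)).union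
        (double X (Term.node x) (ρ A) (Term.lit v))).restrict [ρ A] =
          renamedTr ρ (constTuple A v) := by
      intro x
      funext z
      obtain ⟨B, rfl⟩ := ρ.surjective z
      rw [renamedTr_apply]
      by_cases hB : B = A
      · subst hB
        simp [Mapping.restrict, Mapping.union, single, double, constTuple, Ne.symm hXA]
      · simp [Mapping.restrict, constTuple, hB]
    have e₁ := @mem_eval_triple_var_const (DMpkfk base ids a S K I) X (dataIRI base C R) (.lit v)
      (Term.lit v) rfl fun _ => rfl
    have e₂ := @mem_eval_triple_var_var (DMpkfk base ids a S K I) X (ρ A) hXA (dataIRI base C R)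
    ext μ
    rw [mem_eval_select_nil]
    constructor
    · rintro ⟨_, ⟨μ₁, hμ₁, μ₂, hμ₂, hc, rfl⟩, rfl⟩
      obtain ⟨x, hx, rfl⟩ := e₁.1 hμ₁
      obtain ⟨y, o, hy, rfl⟩ := e₂.1 hμ₂
      rw [mem_DMpkfk_of_models hI, dmTriple_data] at hx hy
      obtain ⟨t, w, -, hw, hr, he⟩ := hx
      obtain ⟨s, u, -, hu, hr', rfl⟩ := hy
      have hxy := hc X (by simp [Mapping.dom, single, double])
      simp only [single, double, if_true, Option.some.injEq, Sum.inl.injEq] at hxy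
      subst hxy
      obtain ⟨-, rfl⟩ := hr.injective hI hr'
      obtain rfl : v = w := Sum.inr.inj he
      obtain rfl : v = u := by simpa [hu] using hw.symm
      exact ⟨_, ⟨rfl, t, hr.mem_rows, hw⟩, (hres x).symm⟩
    · rintro ⟨_, ⟨rfl, s, hs, hv⟩, rfl⟩
      obtain ⟨x, hx⟩ := exists_rowId (base := base) (ids := ids) hI ⟨hC.1, hC.2.2⟩ hs
      have hg := mem_DMpkfk.2 (Or.inl (DMTriple.literal (base := base) (ids := ids) C R s v x hC
        hv hx) : _ ∨ (Violation K I ∧ _ = Node.iri (IRI.res a) ∧ _))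
      refine ⟨_, ⟨_, e₁.2 ⟨x, hg, rfl⟩, _, e₂.2 ⟨x, _, hg, rfl⟩, ?_, rfl⟩, (hres x).symm⟩
      rintro z ⟨hz, -⟩
      have : z = X := by simpa [Mapping.dom, single] using hz
      simp [single, double, this]

/-- SPARQL filters compare with IRIs only. A literal can still be singled out as one that occurs
as a value of an attribute of a class. -/
theorem translatable_const (A : Name) (v : Val) :
    Translatable base ids a K {A} (fun I => {t | t = constTuple A v ∧
      ∃ R C, DataP K C R ∧ ∃ s ∈ I.rows R, s C = some v}) := by
  classical
  let l : List (Name × Name) :=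
    ((S.rels ×ˢ S.rels.biUnion S.att).filter fun p => DataP K p.2 p.1).toList
  have hl : ∀ p : Name × Name, p ∈ l ↔ DataP K p.2 p.1 := by
    intro p
    simp only [l, Finset.mem_toList, Finset.mem_filter, Finset.mem_product, Finset.mem_biUnion,
      and_iff_right_iff_imp]
    exact fun h => ⟨h.1, p.1, h.1, h.2.1⟩
  refine (Translatable.iUnion (K := K) l fun p hp =>
    translatable_column ((hl p).1 hp) A v).congr fun I _ => ?_
  ext t
  simp only [Set.mem_ofPred_eq, hl]
  exact ⟨fun ⟨p, h, e, hs⟩ => ⟨e, p.1, p.2, h, hs⟩, fun ⟨e, R, C, h, hs⟩ => ⟨(R, C), h, e, hs⟩⟩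

/-- The pattern that binds `X` to the node of a tuple of the class `R`, and the variables `ρ A`
of the listed attributes to the values that are not null. -/
def classBody (base : Word) (ρ : Equiv.Perm Name) (X : Var) (R : Name) : List Name → Pattern
  | [] => .triple (.var X) (.iri (IRI.voc .rdfType)) (.iri (classIRI base R))
  | A :: L => .opt (classBody base ρ X R L)
      (.triple (.var X) (.iri (dataIRI base A R)) (.var (ρ A)))

theorem classBody_wf (ρ : Equiv.Perm Name) (X : Var) (R : Name) (L : List Name) :
    (classBody base ρ X R L).WF := by
  induction L with
  | nil => trivial
  | cons A L ih => exact ⟨ih, trivial⟩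

theorem classBody_nonParamIn (ρ : Equiv.Perm Name) (X : Var) (R : Name) (L : List Name)
    (Y : Set Var) : (classBody base ρ X R L).NonParamIn Y := by
  induction L generalizing Y with
  | nil => trivial
  | cons A L ih => exact ⟨ih _, trivial⟩

theorem mem_vars_classBody (ρ : Equiv.Perm Name) (X : Var) (R : Name) (L : List Name) (x : Var)
    (hx : x ∈ (classBody base ρ X R L).vars) : x = X ∨ ∃ A ∈ L, x = ρ A := by
  induction L with
  | nil => simpa [classBody, Pattern.vars, TermPat.vars, PredPat.vars] using hx
  | cons A L ih =>
    rcases hx with hx | hx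
    · rcases ih hx with h | ⟨B, hB, h⟩
      · exact Or.inl h
      · exact Or.inr ⟨B, by simp [hB], h⟩
    · simp only [Pattern.vars, TermPat.vars, PredPat.vars, Set.union_empty, Set.mem_union,
        Set.mem_singleton_iff] at hx
      exact hx.imp_right fun h => ⟨A, by simp, h⟩

/-- The answer of `classBody` for the tuple `t` with the node `x`. -/
def rowMapping (ρ : Equiv.Perm Name) (X : Var) (x : Node) (t : Tuple) (L : List Name) : Mapping :=
  fun z => if z = X then some (Term.node x) else if ρ.symm z ∈ L then renamedTr ρ t z else none

theorem mem_eval_classBody {I : DBInstance S} (hI : I.Models K) {ρ : Equiv.Perm Name} {X : Var}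
    {R : Name} {L : List Name} (hX : ∀ A ∈ L, X ≠ ρ A) (hL : ∀ A ∈ L, DataP K A R) {μ : Mapping} :
    μ ∈ (classBody base ρ X R L).eval (DMpkfk base ids a S K I) ↔
      ∃ t x, RowId base ids K I R t x ∧ μ = rowMapping ρ X x t L := by
  induction L generalizing μ with
  | nil =>
    rw [classBody, mem_eval_triple_var_const rfl fun _ => rfl]
    simp only [mem_DMpkfk_of_models hI, dmTriple_type_class]
    have : ∀ x t, rowMapping ρ X x t [] = single X (Term.node x) := by
      intro x t; funext z; simp [rowMapping, single]
    simp only [this]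
    exact ⟨fun ⟨x, ⟨t, h⟩, e⟩ => ⟨t, x, h, e⟩, fun ⟨t, x, h, e⟩ => ⟨x, ⟨t, h⟩, e⟩⟩
  | cons A L ih =>
    have hXA := hX A (by simp)
    have hA := hL A (by simp)
    have ih := @ih (fun B hB => hX B (by simp [hB])) fun B hB => hL B (by simp [hB])
    have e₂ : ∀ {ν : Mapping}, ν ∈ (Pattern.triple (.var X) (.iri (dataIRI base A R))
        (.var (ρ A))).eval (DMpkfk base ids a S K I) ↔ ∃ t x v, RowId base ids K I R t x ∧
          t A = some v ∧ ν = double X (Term.node x) (ρ A) (Term.lit v) := by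
      intro ν
      rw [mem_eval_triple_var_var hXA]
      simp only [mem_DMpkfk_of_models hI, dmTriple_data]
      constructor
      · rintro ⟨x, _, ⟨t, v, -, hv, hr, rfl⟩, rfl⟩
        exact ⟨t, x, v, hr, hv, rfl⟩
      · rintro ⟨t, x, v, hr, hv, rfl⟩
        exact ⟨x, _, ⟨t, v, hA, hv, hr, rfl⟩, rfl⟩
    -- As `x` determines the tuple, OPT only meets the value of `A` in the same tuple.
    have hcompat : ∀ {t t' x x' v}, RowId base ids K I R t x → RowId base ids K I R t' x' →
        t' A = some v → ((rowMapping ρ X x t L).Compat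
          (double X (Term.node x') (ρ A) (Term.lit v)) ↔ x = x' ∧ t = t') := by
      intro t t' x x' v h h' hv
      constructor
      · intro hc
        have := hc X (by simp [Mapping.dom, rowMapping, double])
        obtain rfl : x = x' := by simpa [rowMapping, double] using this
        exact ⟨rfl, (h.injective hI h').2⟩
      · rintro ⟨rfl, rfl⟩ z ⟨hz, hz'⟩
        by_cases hzX : z = X
        · simp [hzX, rowMapping, double]
        · by_cases hzA : z = ρ A
          · subst hzA
            simp only [Mapping.dom, rowMapping, hzX, if_false, Set.mem_ofPred_eq, ne_eq,
              ite_eq_right_iff, Classical.not_imp] at hz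
            have hAL : A ∈ L := by simpa using hz.1
            simp [rowMapping, double, hzX, hAL, renamedTr_apply, hv]
          · simp [Mapping.dom, double, hzX, hzA] at hz'
    have hunion : ∀ {t x v}, t A = some v → (rowMapping ρ X x t L).union
        (double X (Term.node x) (ρ A) (Term.lit v)) = rowMapping ρ X x t (A :: L) := by
      intro t x v hv
      funext z
      obtain ⟨B, rfl⟩ := ρ.surjective z
      by_cases hzX : ρ B = X
      · simp [Mapping.union, rowMapping, hzX]
      · by_cases hBA : B = A
        · subst hBA
          by_cases hB : B ∈ L <;>
            simp [Mapping.union, rowMapping, double, hzX, hB, renamedTr_apply, hv]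
        · by_cases hB : B ∈ L
          · simp only [Mapping.union, rowMapping, double, hzX, hB, hBA, if_false,
              Equiv.symm_apply_apply, if_true, List.mem_cons, or_true, EmbeddingLike.apply_eq_iff_eq]
            split_ifs with h
            · exact h.symm
            · rfl
          · simp [Mapping.union, rowMapping, double, hzX, hB, hBA]
    have hnone : ∀ {t x}, t A = none → rowMapping ρ X x t (A :: L) = rowMapping ρ X x t L := by
      intro t x hn
      funext z
      obtain ⟨B, rfl⟩ := ρ.surjective z
      by_cases hBA : B = A
      · subst hBA
        simp [rowMapping, renamedTr_apply, hn]
      · simp [rowMapping, hBA]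
    rw [classBody]
    constructor
    · rintro (⟨μ₁, hμ₁, μ₂, hμ₂, hc, rfl⟩ | ⟨hμ, hno⟩)
      · obtain ⟨t, x, h, rfl⟩ := ih.1 hμ₁
        obtain ⟨t', x', v, h', hv, rfl⟩ := e₂.1 hμ₂
        obtain ⟨rfl, rfl⟩ := (hcompat h h' hv).1 hc
        exact ⟨t, x, h, hunion hv⟩
      · obtain ⟨t, x, h, rfl⟩ := ih.1 hμ
        refine ⟨t, x, h, (hnone ?_).symm⟩
        by_contra hn
        obtain ⟨v, hv⟩ := Option.ne_none_iff_exists'.1 hn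
        exact hno _ (e₂.2 ⟨t, x, v, h, hv, rfl⟩) ((hcompat h h hv).2 ⟨rfl, rfl⟩)
    · rintro ⟨t, x, h, rfl⟩
      rcases hv : t A with - | v
      · refine Or.inr ⟨ih.2 ⟨t, x, h, hnone hv⟩, fun μ' hμ' hc => ?_⟩
        obtain ⟨t', x', v, h', hv', rfl⟩ := e₂.1 hμ'
        rw [hnone hv] at hc
        obtain ⟨-, rfl⟩ := (hcompat h h' hv').1 hc
        simp [hv] at hv'
      · exact Or.inl ⟨_, ih.2 ⟨t, x, h, rfl⟩, _, e₂.2 ⟨t, x, v, h, hv, rfl⟩,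
          (hcompat h h hv).2 ⟨rfl, rfl⟩, (hunion hv).symm⟩

theorem translatable_class {R : Name} (hR : IsClass K R) :
    Translatable base ids a K (S.att R) (fun I => I.rows R) := by
  intro ρ F
  obtain ⟨X, hX⟩ := Infinite.exists_notMem_finset ((S.att R).image ρ ∪ F)
  simp only [Finset.mem_union, not_or] at hX
  obtain ⟨hXA, hXF⟩ := hX
  have hXne : ∀ A ∈ (S.att R).toList, X ≠ ρ A := fun A hA h =>
    hXA (h ▸ Finset.mem_image_of_mem _ (Finset.mem_toList.1 hA))
  have hvars : ∀ x ∈ (classBody base ρ X R (S.att R).toList).vars, x = X ∨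
      x ∈ (S.att R).image ρ := fun x hx =>
    (mem_vars_classBody ρ X R _ x hx).imp_right fun ⟨A, hA, h⟩ =>
      h ▸ Finset.mem_image_of_mem _ (Finset.mem_toList.1 hA)
  refine ⟨.select [] ((S.att R).image ρ).toList (classBody base ρ X R (S.att R).toList), {X},
    ⟨classBody_wf _ _ _ _, ?_, by simp⟩, ?_, by simpa using hXF, fun Y hY => ⟨?_,
      classBody_nonParamIn _ _ _ _ _⟩, fun I hI => ?_⟩
  · simpa using Finset.nodup_toList _
  · rintro x (hx | hx)
    · simp only [selectVars, List.map_nil, List.not_mem_nil, Finset.mem_toList, false_or,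
        Set.mem_ofPred_eq] at hx
      exact Or.inl hx
    · simpa using (hvars x hx).symm
  · rintro x hx - hk hxY
    rcases hvars x hx with rfl | hx
    · exact hY _ hxY (by simp)
    · exact hk (Finset.mem_toList.2 hx)
  · have hres : ∀ t ∈ I.rows R, ∀ x : Node, (rowMapping ρ X x t (S.att R).toList).restrict
        ((S.att R).image ρ).toList = renamedTr ρ t := by
      intro t ht x
      funext z
      obtain ⟨A, rfl⟩ := ρ.surjective z
      by_cases hA : A ∈ S.att R
      · have : ρ A ≠ X := (hXne A (Finset.mem_toList.2 hA)).symm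
        simp [Mapping.restrict, rowMapping, hA, this]
      · have hn := I.supp R t ht A hA
        simp [Mapping.restrict, hA, renamedTr_apply, hn]
    ext μ
    rw [mem_eval_select_nil]
    have hbody := @mem_eval_classBody base ids a S K I hI ρ X R _ hXne fun A hA =>
      ⟨hR.1, Finset.mem_toList.1 hA, hR.2⟩
    constructor
    · rintro ⟨μ', hμ', rfl⟩
      obtain ⟨t, x, h, rfl⟩ := hbody.1 hμ'
      exact ⟨t, h.mem_rows, (hres t h.mem_rows x).symm⟩
    · rintro ⟨t, ht, rfl⟩
      obtain ⟨x, hx⟩ := exists_rowId (base := base) (ids := ids) hI hR ht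
      exact ⟨_, hbody.2 ⟨t, x, hx, rfl⟩, (hres t ht x).symm⟩

theorem translatable_binRel {R A B T₁ C T₂ D : Name} (h : BinRel K R A B T₁ C T₂ D) :
    Translatable base ids a K (S.att R) (fun I => I.rows R) := by
  intro ρ F
  have hU : S.att R = {A, B} := by ext; simp [h.mem_att]
  obtain ⟨X, hX⟩ := Infinite.exists_notMem_finset ({ρ A, ρ B} ∪ F)
  obtain ⟨Y, hY⟩ := Infinite.exists_notMem_finset ({X, ρ A, ρ B} ∪ F)
  simp only [Finset.mem_union, Finset.mem_insert, Finset.mem_singleton, not_or] at hX hY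
  obtain ⟨⟨hXA, hXB⟩, hXF⟩ := hX
  obtain ⟨⟨hYX, hYA, hYB⟩, hYF⟩ := hY
  have hAB : ρ A ≠ ρ B := ρ.injective.ne h.ne
  refine ⟨.select [] [ρ A, ρ B] (.and (.and
      (.triple (.var X) (.iri (binIRI base R A B C D)) (.var Y))
      (.triple (.var X) (.iri (dataIRI base C T₁)) (.var (ρ A))))
      (.triple (.var Y) (.iri (dataIRI base D T₂)) (.var (ρ B)))), {X, Y}, ?_, ?_, ?_, ?_,
    fun I hI => ?_⟩
  · simp [Pattern.WF, h.ne]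
  · simp only [Pattern.vars, selectVars, TermPat.vars, PredPat.vars, hU]
    rintro x (hx | hx) <;> simp at hx ⊢ <;> tauto
  · simp [hXF, hYF]
  · intro Z hZ
    refine ⟨fun x hx _ hk hxZ => ?_, ⟨trivial, trivial⟩, trivial⟩
    have := hZ x hxZ
    simp [Pattern.vars, TermPat.vars, PredPat.vars] at hx hk this
    tauto
  · have e₁ := @mem_eval_triple_var_var (DMpkfk base ids a S K I) X Y (Ne.symm hYX)
      (binIRI base R A B C D)
    have e₂ := @mem_eval_triple_var_var (DMpkfk base ids a S K I) X (ρ A) hXA (dataIRI base C T₁)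
    have e₃ := @mem_eval_triple_var_var (DMpkfk base ids a S K I) Y (ρ B) hYB (dataIRI base D T₂)
    simp only [mem_DMpkfk_of_models hI, dmTriple_data] at e₁ e₂ e₃
    have hd : ∀ (Z W : Var) (z w : Term), (double Z z W w).dom = {u | u = Z ∨ u = W} := by
      intro Z W z w
      ext u
      by_cases hu : u = Z
      · simp [Mapping.dom, double, hu]
      · by_cases hu' : u = W
        · subst hu'
          simp [Mapping.dom, double, hu]
        · simp [Mapping.dom, double, hu, hu']
    have hres : ∀ (t : Tuple), t ∈ I.rows R → ∀ (x₁ x₂ : Node) (v w : Val), t A = some v →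
        t B = some w → ((((double X (Term.node x₁) Y (Term.node x₂)).union
          (double X (Term.node x₁) (ρ A) (Term.lit v))).union
          (double Y (Term.node x₂) (ρ B) (Term.lit w))).restrict [ρ A, ρ B]) = renamedTr ρ t := by
      intro t ht x₁ x₂ v w hv hw
      funext z
      obtain ⟨E, rfl⟩ := ρ.surjective z
      rw [renamedTr_apply]
      by_cases hEA : E = A
      · subst hEA
        simp [Mapping.restrict, Mapping.union, double, Ne.symm hXA, Ne.symm hYA, hv]
      · by_cases hEB : E = B
        · subst hEB
          simp [Mapping.restrict, Mapping.union, double, Ne.symm hXB, Ne.symm hYB, hw, hEA]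
        · have := I.supp R t ht E (by simp [hU, hEA, hEB])
          simp [Mapping.restrict, hEA, hEB, this]
    ext μ
    rw [mem_eval_select_nil]
    constructor
    · rintro ⟨_, ⟨_, ⟨μ₁, hμ₁, μ₂, hμ₂, hc, rfl⟩, μ₃, hμ₃, hc', rfl⟩, rfl⟩
      obtain ⟨x₁, o, hb, rfl⟩ := e₁.1 hμ₁
      obtain ⟨x₁', _, ⟨t₁', v, -, hv, hr₁', rfl⟩, rfl⟩ := e₂.1 hμ₂
      obtain ⟨x₂', _, ⟨t₂', w, -, hw, hr₂', rfl⟩, rfl⟩ := e₃.1 hμ₃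
      obtain ⟨R', A', B', T₁', C', T₂', D', t, t₁, t₂, x₂, hp, h', ht, hA, hB, hr₁, hr₂, rfl⟩ :=
        (dmTriple_bin (by simp)).1 hb
      have hR : R = R' := by
        have := congrArg (iriFields base) hp
        simp only [iriFields_bin, List.cons.injEq] at this
        exact this.1
      subst hR
      obtain ⟨rfl, rfl, rfl, rfl, rfl, rfl⟩ := h.unique h'
      have hx := hc X (by simp [hd])
      obtain rfl : x₁ = x₁' := by simpa [double] using hx
      have hy := hc' Y (by simp [Mapping.dom, Mapping.union, double, hYX])
      obtain rfl : x₂ = x₂' := by simpa [double, Mapping.union, hYX] using hy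
      obtain ⟨-, rfl⟩ := hr₁.injective hI hr₁'
      obtain ⟨-, rfl⟩ := hr₂.injective hI hr₂'
      exact ⟨t, ht, (hres t ht x₁ x₂ v w (hA.trans hv) (hB.trans hw)).symm⟩
    · rintro ⟨t, ht, rfl⟩
      obtain ⟨t₁, t₂, x₁, x₂, v, w, hr₁, hr₂, hA, hC, hB, hD⟩ :=
        h.exists_refs (base := base) (ids := ids) hI ht
      refine ⟨_, ⟨_, ⟨_, e₁.2 ⟨x₁, _, .binRef R A B T₁ C T₂ D t t₁ t₂ x₁ x₂ h ht
        (hA.trans hC.symm) (hB.trans hD.symm) hr₁ hr₂, rfl⟩, _,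
        e₂.2 ⟨x₁, _, ⟨t₁, v, h.data₁, hC, hr₁, rfl⟩, rfl⟩, ?_, rfl⟩, _,
        e₃.2 ⟨x₂, _, ⟨t₂, w, h.data₂, hD, hr₂, rfl⟩, rfl⟩, ?_, rfl⟩,
        (hres t ht x₁ x₂ v w hA hB).symm⟩
      · rintro z ⟨hz, hz'⟩
        rw [hd] at hz hz'
        rcases hz with rfl | rfl
        · simp [double]
        · rcases hz' with hz' | hz'
          exacts [absurd hz' hYX, absurd hz' hYA]
      · rintro z ⟨hz, hz'⟩
        rw [hd] at hz'
        rcases hz' with rfl | rfl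
        · simp [double, Mapping.union, hYX]
        · simp [Mapping.dom, Mapping.union, double, Ne.symm hXB, Ne.symm hYB, Ne.symm hAB] at hz

theorem translatable_rel {R : Name} (hR : R ∈ S.rels) :
    Translatable base ids a K (S.att R) (fun I => I.rows R) := by
  by_cases hb : IsBinRel K R
  · obtain ⟨A, B, T₁, C, T₂, D, hb⟩ := hb
    exact translatable_binRel hb
  · exact translatable_class ⟨hR, hb⟩

end Relations

/-! ### Translating relational algebra -/

section Algebra

variable {S : Schema} {K : ConstraintSet S} {I : DBInstance S}

theorem RAExpr.eval_supp (Q : RAExpr) (hQ : Q.WF S) {t : Tuple} (ht : t ∈ Q.eval I) {A : Name}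
    (hA : A ∉ Q.att S) : t A = none := by
  induction Q generalizing t A with
  | rel R => exact I.supp R t ht A hA
  | null B => rw [Set.mem_singleton_iff.1 ht]
  | selEq B v e ih => exact ih hQ.1 ht.1 hA
  | selNe B v e ih => exact ih hQ.1 ht.1 hA
  | selNull B e ih => exact ih hQ.1 ht.1 hA
  | selNotNull B e ih => exact ih hQ.1 ht.1 hA
  | proj U e ih =>
    obtain ⟨_, -, -, h⟩ := ht
    exact h A hA
  | rename B C e ih =>
    obtain ⟨_, -, -, -, h⟩ := ht
    exact h A hA
  | join e₁ e₂ ih₁ ih₂ =>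
    obtain ⟨_, -, _, -, -, -, -, h⟩ := ht
    exact h A hA
  | union e₁ e₂ ih₁ ih₂ =>
    rcases ht with ht | ht
    · exact ih₁ hQ.1 ht hA
    · exact ih₂ hQ.2.1 ht (by rw [← hQ.2.2]; exact hA)
  | diff e₁ e₂ ih₁ ih₂ => exact ih₁ hQ.1 ht.1 hA

/-- Every value in the answer of a query occurs in a class: those of a binary relation occur in
the classes that it references. -/
theorem RAExpr.eval_mem_class (hI : I.Models K) (Q : RAExpr) (hQ : Q.WF S) {t : Tuple}
    (ht : t ∈ Q.eval I) {A : Name} {v : Val} (hv : t A = some v) :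
    ∃ R C, DataP K C R ∧ ∃ s ∈ I.rows R, s C = some v := by
  induction Q generalizing t A with
  | rel R =>
    have hA : A ∈ S.att R := by
      by_contra hA
      simp [I.supp R t ht A hA] at hv
    by_cases hb : IsBinRel K R
    · obtain ⟨A', B, T₁, C, T₂, D, hb⟩ := hb
      obtain ⟨t₁, t₂, x₁, x₂, u, w, h₁, h₂, hu, hC, hw, hD⟩ :=
        hb.exists_refs (base := []) (ids := Classical.arbitrary _) hI ht
      rcases (hb.mem_att A).1 hA with rfl | rfl
      · exact ⟨T₁, C, hb.data₁, t₁, h₁.mem_rows, by rw [hC, ← hu, hv]⟩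
      · exact ⟨T₂, D, hb.data₂, t₂, h₂.mem_rows, by rw [hD, ← hw, hv]⟩
    · exact ⟨R, A, ⟨hQ, hA, hb⟩, t, ht, hv⟩
  | null B => simp [Set.mem_singleton_iff.1 ht] at hv
  | selEq B v e ih => exact ih hQ.1 ht.1 hv
  | selNe B v e ih => exact ih hQ.1 ht.1 hv
  | selNull B e ih => exact ih hQ.1 ht.1 hv
  | selNotNull B e ih => exact ih hQ.1 ht.1 hv
  | proj U e ih =>
    obtain ⟨t', ht', h, h'⟩ := ht
    by_cases hA : A ∈ U
    · exact ih hQ.1 ht' ((h A hA).symm.trans hv)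
    · simp [h' A hA] at hv
  | rename B C e ih =>
    obtain ⟨t', ht', h, h', h''⟩ := ht
    by_cases hA : A = C
    · subst hA
      exact ih hQ.1 ht' (h.symm.trans hv)
    · by_cases hA' : A ∈ e.att S \ {B}
      · exact ih hQ.1 ht' ((h' A hA').symm.trans hv)
      · simp [h'' A (by simpa [hA] using hA')] at hv
  | join e₁ e₂ ih₁ ih₂ =>
    obtain ⟨t₁, ht₁, t₂, ht₂, h, h₁, h₂, h'⟩ := ht
    by_cases hA₁ : A ∈ e₁.att S
    · refine ih₁ hQ.1 ht₁ (A := A) ?_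
      by_cases hA₂ : A ∈ e₂.att S
      · rw [← (h A (by simp [hA₁, hA₂])).1, hv]
      · rw [← h₁ A (by simp [hA₁, hA₂]), hv]
    · by_cases hA₂ : A ∈ e₂.att S
      · exact ih₂ hQ.2 ht₂ (by rw [← h₂ A (by simp [hA₁, hA₂]), hv])
      · simp [h' A (by simp [hA₁, hA₂])] at hv
  | union e₁ e₂ ih₁ ih₂ =>
    rcases ht with ht | ht
    · exact ih₁ hQ.1 ht hv
    · exact ih₂ hQ.2.1 ht hv
  | diff e₁ e₂ ih₁ ih₂ => exact ih₁ hQ.1 ht.1 hv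

variable {base : Word} {ids : TupleIds} {a : Word}

theorem Translatable.selEq {e : RAExpr} (he : e.WF S) {A : Name} (hA : A ∈ e.att S)
    (h : Translatable base ids a K (e.att S) fun I => e.eval I) (v : Val) :
    Translatable base ids a K (e.att S) fun I => (RAExpr.selEq A v e).eval I := by
  have := (h.notNull hA).combine (translatable_const A v)
  rw [Finset.union_eq_left.2 (Finset.singleton_subset_iff.2 hA)] at this
  refine this.congr fun I hI => ?_
  ext t
  constructor
  · rintro ⟨t₁, ⟨ht₁, hn⟩, _, ⟨rfl, -⟩, hc, rfl⟩
    have hv : t₁ A = some v := by simpa [constTuple] using hc A hn (by simp [constTuple])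
    have : tupleUnion t₁ (constTuple A v) = t₁ := by
      funext B
      by_cases hB : B = A
      · simp [tupleUnion, hB, hv]
      · simp [tupleUnion, constTuple, hB]
    rw [this]
    exact ⟨ht₁, hv⟩
  · rintro ⟨ht, hv⟩
    refine ⟨t, ⟨ht, by simp [hv]⟩, _, ⟨rfl, e.eval_mem_class hI he ht hv⟩, fun B _ hB => ?_, ?_⟩
    · have : B = A := by simpa [constTuple] using hB
      simp [this, hv, constTuple]
    · funext B
      by_cases hB : B = A
      · simp [tupleUnion, hB, hv]
      · simp [tupleUnion, constTuple, hB]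

theorem Translatable.rename {e : RAExpr} (he : e.WF S) {A B : Name} (hA : A ∈ e.att S)
    (hB : B ∉ e.att S) (h : Translatable base ids a K (e.att S) fun I => e.eval I) :
    Translatable base ids a K ((e.att S \ {A}) ∪ {B}) fun I => (RAExpr.rename A B e).eval I := by
  have hAB : A ≠ B := fun h => hB (h ▸ hA)
  have := h.perm (Equiv.swap A B)
  have hU : (e.att S).image (Equiv.swap A B) = (e.att S \ {A}) ∪ {B} := by
    ext C
    simp only [Finset.mem_image, Finset.mem_union, Finset.mem_sdiff, Finset.mem_singleton]
    constructor
    · rintro ⟨D, hD, rfl⟩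
      by_cases hDA : D = A
      · simp [hDA]
      · have hDB : D ≠ B := fun h => hB (h ▸ hD)
        simp [Equiv.swap_apply_of_ne_of_ne hDA hDB, hD, hDA]
    · rintro (⟨hC, hCA⟩ | rfl)
      · exact ⟨C, hC, Equiv.swap_apply_of_ne_of_ne hCA fun h => hB (h ▸ hC)⟩
      · exact ⟨A, hA, by simp⟩
  rw [hU] at this
  refine this.congr fun I _ => ?_
  have key : ∀ t' ∈ e.eval I, ∀ t : Tuple, (t B = t' A ∧ (∀ C ∈ e.att S \ {A}, t C = t' C) ∧
      ∀ C, C ∉ (e.att S \ {A}) ∪ {B} → t C = none) ↔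
        (fun C => t' ((Equiv.swap A B).symm C)) = t := by
    intro t' ht' t
    simp only [Equiv.symm_swap]
    have hnB := e.eval_supp he ht' hB
    constructor
    · rintro ⟨h1, h2, h3⟩
      funext C
      by_cases hCB : C = B
      · simp [hCB, h1]
      · by_cases hCA : C = A
        · simp [hCA, hnB, h3 A (by simp [hAB])]
        · rw [Equiv.swap_apply_of_ne_of_ne hCA hCB]
          by_cases hC : C ∈ e.att S
          · rw [h2 C (by simp [hC, hCA])]
          · rw [h3 C (by simp [hC, hCB]), e.eval_supp he ht' hC]
    · rintro rfl
      refine ⟨by simp, fun C hC => ?_, fun C hC => ?_⟩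
      · simp only [Finset.mem_sdiff, Finset.mem_singleton] at hC
        have hCB : C ≠ B := fun h => hB (h ▸ hC.1)
        simp only [Equiv.swap_apply_of_ne_of_ne hC.2 hCB]
      · simp only [Finset.mem_union, Finset.mem_sdiff, Finset.mem_singleton, not_or,
          not_and, not_not] at hC
        by_cases hCA : C = A
        · simp [hCA, hnB]
        · simp only [Equiv.swap_apply_of_ne_of_ne hCA hC.2]
          exact e.eval_supp he ht' fun h => hCA (hC.1 h)
  ext t
  exact ⟨fun ⟨t', ht', h⟩ => ⟨t', ht', (key t' ht' t).2 h⟩,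
    fun ⟨t', ht', h⟩ => ⟨t', ht', (key t' ht' t).1 h⟩⟩

/-- The algebra joins on shared attributes that are not null; SPARQL's AND treats an unbound
variable as compatible with everything. The two agree once the tuples with a null in a shared
attribute have been filtered out of both arguments. -/
theorem Translatable.join {e₁ e₂ : RAExpr} (he₁ : e₁.WF S) (he₂ : e₂.WF S)
    (h₁ : Translatable base ids a K (e₁.att S) fun I => e₁.eval I)
    (h₂ : Translatable base ids a K (e₂.att S) fun I => e₂.eval I) :
    Translatable base ids a K (e₁.att S ∪ e₂.att S) fun I => (RAExpr.join e₁ e₂).eval I := by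
  have := (h₁.notNull_list (e₁.att S ∩ e₂.att S).toList (by simp +contextual)).combine
    (h₂.notNull_list (e₁.att S ∩ e₂.att S).toList (by simp +contextual))
  refine this.congr fun I _ => ?_
  simp only [Finset.mem_toList, Finset.mem_inter]
  ext t
  constructor
  · rintro ⟨t₁, ⟨ht₁, hn₁⟩, t₂, ⟨ht₂, hn₂⟩, hc, rfl⟩
    refine ⟨t₁, ht₁, t₂, ht₂, fun A hA => ?_, fun A hA => ?_, fun A hA => ?_, fun A hA => ?_⟩
    · have hA := Finset.mem_inter.1 hA
      obtain ⟨v, hv⟩ := Option.ne_none_iff_exists'.1 (hn₁ A hA)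
      have := hc A (hn₁ A hA) (hn₂ A hA)
      simp [tupleUnion, ← this, hv]
    · simp [tupleUnion, e₂.eval_supp he₂ ht₂ (Finset.mem_sdiff.1 hA).2]
    · simp [tupleUnion, e₁.eval_supp he₁ ht₁ (Finset.mem_sdiff.1 hA).2]
    · simp only [Finset.mem_union, not_or] at hA
      simp [tupleUnion, e₁.eval_supp he₁ ht₁ hA.1, e₂.eval_supp he₂ ht₂ hA.2]
  · rintro ⟨t₁, ht₁, t₂, ht₂, h, hl, hr, hn⟩
    refine ⟨t₁, ⟨ht₁, fun A hA => ?_⟩, t₂, ⟨ht₂, fun A hA => ?_⟩, fun A hA₁ hA₂ => ?_, ?_⟩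
    · have := h A (Finset.mem_inter.2 hA)
      rw [← this.1]; exact this.2.2
    · have := h A (Finset.mem_inter.2 hA)
      rw [← this.2.1]; exact this.2.2
    · have := h A (Finset.mem_inter.2 ⟨not_imp_comm.1 (e₁.eval_supp he₁ ht₁) hA₁,
        not_imp_comm.1 (e₂.eval_supp he₂ ht₂) hA₂⟩)
      rw [← this.1, ← this.2.1]
    · funext A
      by_cases hA₁ : A ∈ e₁.att S
      · by_cases hA₂ : A ∈ e₂.att S
        · obtain ⟨e1, e2, e3⟩ := h A (by simp [hA₁, hA₂])
          simp [tupleUnion, ← e1, ← e2]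
        · simp [tupleUnion, hl A (by simp [hA₁, hA₂]), e₂.eval_supp he₂ ht₂ hA₂]
      · by_cases hA₂ : A ∈ e₂.att S
        · simp [tupleUnion, hr A (by simp [hA₁, hA₂]), e₁.eval_supp he₁ ht₁ hA₁]
        · simp [tupleUnion, hn A (by simp [hA₁, hA₂]), e₁.eval_supp he₁ ht₁ hA₁,
            e₂.eval_supp he₂ ht₂ hA₂]

theorem RAExpr.translatable (hS : S.rels.Nonempty) (Q : RAExpr) (hQ : Q.WF S) :
    Translatable base ids a K (Q.att S) fun I => Q.eval I := by
  induction Q with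
  | rel R => exact translatable_rel hQ
  | null A => exact (translatable_null hS).mono (Finset.empty_subset _)
  | selEq A v e ih => exact (ih hQ.1).selEq hQ.1 hQ.2 v
  | selNe A v e ih =>
    -- The nulls, which both selections drop, have to be removed before taking the difference.
    refine (((ih hQ.1).notNull hQ.2).diff hS ((ih hQ.1).selEq hQ.1 hQ.2 v)
      (fun I t ht B hB => e.eval_supp hQ.1 ht.1 hB)
      (fun I t ht B hB => e.eval_supp hQ.1 ht.1 hB)).congr fun I _ => ?_
    ext t
    simp only [RAExpr.eval, Set.mem_sdiff, Set.mem_ofPred_eq]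
    tauto
  | selNull A e ih => exact (ih hQ.1).isNull hQ.2
  | selNotNull A e ih => exact (ih hQ.1).notNull hQ.2
  | proj U e ih =>
    refine ((ih hQ.1).proj U).congr fun I _ => ?_
    ext t
    constructor
    · rintro ⟨t', ht', rfl⟩
      exact ⟨t', ht', fun A hA => by simp [restrictTuple, hA], fun A hA => by
        simp [restrictTuple, hA]⟩
    · rintro ⟨t', ht', h1, h2⟩
      refine ⟨t', ht', funext fun A => ?_⟩
      by_cases hA : A ∈ U
      · simp [restrictTuple, hA, h1 A hA]
      · simp [restrictTuple, hA, h2 A hA]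
  | rename A B e ih => exact (ih hQ.1).rename hQ.1 hQ.2.1 hQ.2.2
  | join e₁ e₂ ih₁ ih₂ => exact (ih₁ hQ.1).join hQ.1 hQ.2 (ih₂ hQ.2)
  | union e₁ e₂ ih₁ ih₂ =>
    have := (ih₁ hQ.1).union (ih₂ hQ.2.1)
    rwa [← hQ.2.2, Finset.union_self] at this
  | diff e₁ e₂ ih₁ ih₂ =>
    have h₂ := ih₂ hQ.2.1
    rw [← hQ.2.2] at h₂
    exact (ih₁ hQ.1).diff hS h₂ (fun I t ht A hA => e₁.eval_supp hQ.1 ht hA)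
      fun I t ht A hA => e₂.eval_supp hQ.2.1 ht (hQ.2.2 ▸ hA)

end Algebra

theorem queryPreserving_DMpkfk (base : Word) (ids : TupleIds) (a : Word) :
    QueryPreserving (DMpkfk base ids a) := by
  intro S hS K Q hQ
  obtain ⟨P, H, h1, -, -, h4, h5⟩ := Q.translatable (base := base) (ids := ids) (a := a) (K := K)
    hS hQ (Equiv.refl _) ∅
  exact ⟨P, h1, h4 ∅ (by simp), fun I hI => (h5 I hI).symm⟩

/-! ### Recovering the database from the graph -/

section Canonical

open Encodable

variable {α : Type*} [Primcodable α]

/-- A bound on the codes of the members of a list. -/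
def codeBound (l : List α) : ℕ := l.foldr (fun g m => max (encode g + 1) m) 0

theorem codeBound_le_iff (l : List α) (n : ℕ) : codeBound l ≤ n ↔ ∀ g ∈ l, encode g < n := by
  induction l with
  | nil => simp [codeBound]
  | cons g l ih =>
    have : codeBound (g :: l) = max (encode g + 1) (codeBound l) := rfl
    rw [this, max_le_iff, ih]
    simp

variable [DecidableEq α]

/-- The members of a list in the order of their codes and without repetitions: a list that
depends only on the set of the members. -/
def canonicalList (l : List α) : List α :=
  (List.range (codeBound l)).filterMap fun n =>
    (decode n : Option α).bind fun g => if g ∈ l then some g else none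

theorem canonicalList_congr {l l' : List α} (h : ∀ g, g ∈ l ↔ g ∈ l') :
    canonicalList l = canonicalList l' := by
  have hb : codeBound l = codeBound l' := le_antisymm
    ((codeBound_le_iff _ _).2 fun g hg => (codeBound_le_iff l' _).1 le_rfl g ((h g).1 hg))
    ((codeBound_le_iff _ _).2 fun g hg => (codeBound_le_iff l _).1 le_rfl g ((h g).2 hg))
  simp only [canonicalList, hb, h]

theorem mem_canonicalList {l : List α} {g : α} : g ∈ canonicalList l ↔ g ∈ l := by
  simp only [canonicalList, List.mem_filterMap, List.mem_range, Option.bind_eq_some_iff,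
    Option.ite_none_right_eq_some, Option.some.injEq]
  constructor
  · rintro ⟨n, -, g', -, hg, rfl⟩
    exact hg
  · intro hg
    exact ⟨encode g, (codeBound_le_iff l _).1 le_rfl g hg, g, encodek g, hg, rfl⟩

theorem primrec_canonicalList : Primrec (canonicalList : List α → List α) := by
  have hb : Primrec (codeBound : List α → ℕ) :=
    Primrec.list_foldr Primrec.id (Primrec.const 0)
      (Primrec.nat_max.comp
        (Primrec.succ.comp (Primrec.encode.comp (Primrec.fst.comp Primrec.snd)))
        (Primrec.snd.comp Primrec.snd)).to₂
  have hmem : PrimrecRel fun (l : List α) (g : α) => g ∈ l :=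
    (PrimrecRel.exists_mem_list Primrec.eq).of_eq fun l g => by simp
  refine Primrec.listFilterMap (Primrec.list_range.comp hb) ?_
  refine Primrec.option_bind (Primrec.decode.comp Primrec.snd) ?_
  exact Primrec.ite (hmem.comp (Primrec.fst.comp Primrec.fst) Primrec.snd)
    (Primrec.option_some.comp Primrec.snd) (Primrec.const none)

end Canonical

section Decoding

instance : DecidableEq Term := instDecidableEqSum

instance : DecidableEq Triple := instDecidableEqProd

variable (base : Word)

/-- The fields of a node that is an IRI. -/
def nodeFields : Node → List Name := fun x => x.casesOn (iriFields base) fun _ => []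

/-- The fields of a term that is an IRI. -/
def termFields : Term → List Name := fun x => x.casesOn (nodeFields base) fun _ => []

/-- The attribute and its value that a triple with a literal as object describes. -/
def literalEntry (g : Triple) : List (Name × Val) :=
  g.2.2.casesOn (fun _ => []) fun v => [((iriFields base g.2.1).getD 1 [], v)]

/-- The attributes and values of the node `y`. -/
def nodeRow (l : List Triple) (y : Term) : List (Name × Val) :=
  l.flatMap fun g => if Term.node g.1 = y then literalEntry base g else []

/-- The pairs (relation, attribute) that a declaration of a property describes. -/
def attCode (g : Triple) : List (Name × Name) :=
  if g.2.2 = Term.iri (IRI.voc .owlDatatypeProperty) then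
    [((nodeFields base g.1).getD 0 [], (nodeFields base g.1).getD 1 [])]
  else if g.2.2 = Term.iri (IRI.voc .owlObjectProperty) ∧ (nodeFields base g.1).length = 5 then
    [((nodeFields base g.1).getD 0 [], (nodeFields base g.1).getD 1 []),
      ((nodeFields base g.1).getD 0 [], (nodeFields base g.1).getD 2 [])]
  else []

/-- The row that a triple describes if it gives the type of the node of a tuple. -/
def classRowCode (l : List Triple) (g : Triple) : List (Name × List (Name × Val)) :=
  if g.2.1 = IRI.voc .rdfType ∧ (termFields base g.2.2).length = 1 then
    [((termFields base g.2.2).getD 0 [], nodeRow base l (Term.node g.1))]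
  else []

/-- The row of a binary relation that joins an attribute of one node with one of another. -/
def joinCode (fs : List Name) (p q : Name × Val) : List (Name × List (Name × Val)) :=
  if p.1 = fs.getD 3 [] ∧ q.1 = fs.getD 4 [] then
    [(fs.getD 0 [], [(fs.getD 1 [], p.2), (fs.getD 2 [], q.2)])]
  else []

/-- The rows that a triple describes if its predicate is that of a binary relation. -/
def binRowCode (l : List Triple) (g : Triple) : List (Name × List (Name × Val)) :=
  if (iriFields base g.2.1).length = 5 then
    (nodeRow base l (Term.node g.1)).flatMap fun p =>
      (nodeRow base l g.2.2).flatMap fun q => joinCode (iriFields base g.2.1) p q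
  else []

/-- The database described by the triples in a list. -/
def dbCode (l : List Triple) : DBCode :=
  (l.flatMap (attCode base), l.flatMap fun g => classRowCode base l g ++ binRowCode base l g)

/-! ### Computability -/

theorem primrec_fields : Primrec fields := by
  have hstep : Primrec₂ fun (_ : Word) (p : Sym × List Name) =>
      (p.1.casesOn (fun n => (n :: p.2.headI) :: p.2.tail) fun _ => [] :: p.2 : List Name) := by
    refine Primrec.sumCasesOn (Primrec.fst.comp Primrec.snd) ?_ ?_
    · have h2 : Primrec fun x : (Word × Sym × List Name) × ℕ => x.1.2.2 :=
        Primrec.snd.comp (Primrec.snd.comp Primrec.fst)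
      exact Primrec.list_cons.comp
        (Primrec.list_cons.comp Primrec.snd (Primrec.list_headI.comp h2))
        (Primrec.list_tail.comp h2)
    · exact Primrec.list_cons.comp (Primrec.const [])
        (Primrec.snd.comp (Primrec.snd.comp Primrec.fst))
  exact Primrec.list_foldr Primrec.id (Primrec.const [[]]) hstep

theorem primrec_iriFields : Primrec (iriFields base) :=
  Primrec.sumCasesOn Primrec.id (Primrec.const []).to₂
    (primrec_fields.comp (Primrec.list_drop.comp (Primrec.const base.length) Primrec.snd)).to₂

theorem primrec_nodeFields : Primrec (nodeFields base) :=
  Primrec.sumCasesOn Primrec.id ((primrec_iriFields base).comp Primrec.snd).to₂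
    (Primrec.const []).to₂

theorem primrec_termFields : Primrec (termFields base) :=
  Primrec.sumCasesOn Primrec.id ((primrec_nodeFields base).comp Primrec.snd).to₂
    (Primrec.const []).to₂

theorem Primrec.getD_const {α : Type*} [Primcodable α] {f : α → List Name} (hf : Primrec f)
    (n : ℕ) : Primrec fun x => (f x).getD n [] :=
  (Primrec.list_getD []).comp hf (Primrec.const n)

theorem primrec_literalEntry : Primrec (literalEntry base) := by
  refine Primrec.sumCasesOn (Primrec.snd.comp Primrec.snd) (Primrec.const []).to₂ ?_
  have h : Primrec fun x : Triple × Val => iriFields base x.1.2.1 :=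
    (primrec_iriFields base).comp (Primrec.fst.comp (Primrec.snd.comp Primrec.fst))
  exact Primrec.list_cons.comp (Primrec.pair (Primrec.getD_const h 1) Primrec.snd)
    (Primrec.const [])

theorem primrec_nodeRow : Primrec₂ (nodeRow base) := by
  refine Primrec.list_flatMap Primrec.fst ?_
  refine Primrec.ite (Primrec.eq.comp ?_ (Primrec.snd.comp Primrec.fst))
    ((primrec_literalEntry base).comp Primrec.snd) (Primrec.const [])
  exact Primrec.sumInl.comp (Primrec.fst.comp Primrec.snd)

theorem primrec_attCode : Primrec (attCode base) := by
  have hs : Primrec fun g : Triple => nodeFields base g.1 :=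
    (primrec_nodeFields base).comp Primrec.fst
  have ho : Primrec fun g : Triple => g.2.2 := Primrec.snd.comp Primrec.snd
  have hpair : ∀ n, Primrec fun g : Triple =>
      ((nodeFields base g.1).getD 0 [], (nodeFields base g.1).getD n []) := fun n =>
    Primrec.pair (Primrec.getD_const hs 0) (Primrec.getD_const hs n)
  refine Primrec.ite (Primrec.eq.comp ho (Primrec.const _)) ?_ (Primrec.ite
    ((Primrec.eq.comp ho (Primrec.const _)).and
      (Primrec.eq.comp (Primrec.list_length.comp hs) (Primrec.const 5))) ?_ (Primrec.const []))
  · exact Primrec.list_cons.comp (hpair 1) (Primrec.const [])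
  · exact Primrec.list_cons.comp (hpair 1) (Primrec.list_cons.comp (hpair 2) (Primrec.const []))

theorem primrec_classRowCode : Primrec₂ (classRowCode base) := by
  have hs : Primrec fun x : List Triple × Triple => x.2.1 := Primrec.fst.comp Primrec.snd
  have hp : Primrec fun x : List Triple × Triple => x.2.2.1 :=
    Primrec.fst.comp (Primrec.snd.comp Primrec.snd)
  have ho : Primrec fun x : List Triple × Triple => termFields base x.2.2.2 :=
    (primrec_termFields base).comp (Primrec.snd.comp (Primrec.snd.comp Primrec.snd))
  refine Primrec.ite ((Primrec.eq.comp hp (Primrec.const _)).and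
    (Primrec.eq.comp (Primrec.list_length.comp ho) (Primrec.const 1))) ?_ (Primrec.const [])
  exact Primrec.list_cons.comp (Primrec.pair (Primrec.getD_const ho 0)
    ((primrec_nodeRow base).comp Primrec.fst (Primrec.sumInl.comp hs))) (Primrec.const [])

theorem primrec_joinCode : Primrec fun x : List Name × (Name × Val) × (Name × Val) =>
    joinCode x.1 x.2.1 x.2.2 := by
  have hf := @Primrec.fst (List Name) ((Name × Val) × (Name × Val)) _ _
  have hp : Primrec fun x : List Name × (Name × Val) × (Name × Val) => x.2.1 :=
    Primrec.fst.comp Primrec.snd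
  have hq : Primrec fun x : List Name × (Name × Val) × (Name × Val) => x.2.2 :=
    Primrec.snd.comp Primrec.snd
  refine Primrec.ite ((Primrec.eq.comp (Primrec.fst.comp hp) (Primrec.getD_const hf 3)).and
    (Primrec.eq.comp (Primrec.fst.comp hq) (Primrec.getD_const hf 4))) ?_ (Primrec.const [])
  refine Primrec.list_cons.comp (Primrec.pair (Primrec.getD_const hf 0) ?_) (Primrec.const [])
  exact Primrec.list_cons.comp (Primrec.pair (Primrec.getD_const hf 1) (Primrec.snd.comp hp))
    (Primrec.list_cons.comp (Primrec.pair (Primrec.getD_const hf 2) (Primrec.snd.comp hq))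
      (Primrec.const []))

theorem primrec_binRowCode : Primrec₂ (binRowCode base) := by
  have hs : Primrec fun x : List Triple × Triple => x.2.1 := Primrec.fst.comp Primrec.snd
  have hp : Primrec fun x : List Triple × Triple => iriFields base x.2.2.1 :=
    (primrec_iriFields base).comp (Primrec.fst.comp (Primrec.snd.comp Primrec.snd))
  have ho : Primrec fun x : List Triple × Triple => x.2.2.2 :=
    Primrec.snd.comp (Primrec.snd.comp Primrec.snd)
  refine Primrec.ite (Primrec.eq.comp (Primrec.list_length.comp hp) (Primrec.const 5)) ?_
    (Primrec.const [])
  refine Primrec.list_flatMap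
    ((primrec_nodeRow base).comp Primrec.fst (Primrec.sumInl.comp hs)) ?_
  refine Primrec.list_flatMap
    (((primrec_nodeRow base).comp Primrec.fst ho).comp Primrec.fst) ?_
  exact primrec_joinCode.comp (Primrec.pair (hp.comp (Primrec.fst.comp Primrec.fst))
    (Primrec.pair (Primrec.snd.comp Primrec.fst) Primrec.snd))

theorem primrec_dbCode : Primrec (dbCode base) :=
  Primrec.pair (Primrec.list_flatMap Primrec.id ((primrec_attCode base).comp Primrec.snd).to₂)
    (Primrec.list_flatMap Primrec.id (Primrec.list_append.comp (primrec_classRowCode base)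
      (primrec_binRowCode base)).to₂)

end Decoding

/-! ### Correctness of the reconstruction -/

section Correctness

variable {base : Word} {ids : TupleIds} {S : Schema} {K : ConstraintSet S} {I : DBInstance S}
  {l : List Triple}

theorem lookup_eq_of_mem_iff {α β : Type*} [BEq α] [LawfulBEq α] {r : List (α × β)} {A : α}
    {o : Option β} (h : ∀ v, (A, v) ∈ r ↔ o = some v) : r.lookup A = o := by
  rcases ho : r.lookup A with - | v
  · rw [List.lookup_eq_none_iff] at ho
    rcases o with - | w
    · rfl
    · simpa using ho _ ((h w).2 rfl)
  · obtain ⟨l₁, l₂, rfl, -⟩ := List.lookup_eq_some_iff.1 ho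
    exact ((h v).1 (by simp)).symm

theorem toDB_eq {c : DBCode} (hS : ∀ R A, (R, A) ∈ c.1 ↔ A ∈ S.att R)
    (hI : ∀ R t, R ∈ S.rels → (t ∈ I.rows R ↔ ∃ row, (R, row) ∈ c.2 ∧
      t = fun A => if A ∈ S.att R then row.lookup A else none)) : c.toDB = ⟨S, I⟩ := by
  have hatt : c.schema.att = S.att := by
    funext R
    ext A
    rw [← hS]
    simp [DBCode.schema]
  have hrels : c.schema.rels = S.rels := by
    ext R
    simp only [DBCode.schema, List.mem_toFinset, List.mem_map, Prod.exists, exists_and_right,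
      exists_eq_right, hS]
    constructor
    · rintro ⟨A, hA⟩
      by_contra hR
      simp [S.att_out R hR] at hA
    · exact fun hR => S.att_nonempty R hR
  have hSc : c.schema = S := Schema.ext hrels hatt
  subst hSc
  have : c.inst = I := by
    ext R t
    by_cases hR : R ∈ c.schema.rels
    · rw [hI R t hR]
      simp only [DBCode.inst, Set.mem_ofPred_eq, hR, true_and]
      rfl
    · rw [I.rows_out R hR, c.inst.rows_out R hR]
  rw [DBCode.toDB, this]

theorem mem_nodeRow (hI : I.Models K)
    (hl : ∀ x p y, (x, p, y) ∈ l ↔ DMTriple base ids K I x p y) {R : Name} {t : Tuple} {x : Node}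
    (h : RowId base ids K I R t x) {A : Name} {v : Val} :
    (A, v) ∈ nodeRow base l (Term.node x) ↔ t A = some v := by
  simp only [nodeRow, List.mem_flatMap]
  constructor
  · rintro ⟨⟨x', p, y⟩, hg, hmem⟩
    split_ifs at hmem with hx
    · obtain rfl : x' = x := Sum.inl.inj hx
      rcases y with y | w
      · simp [literalEntry] at hmem
      · rw [hl] at hg
        cases hg with
        | literal A' R' t' _ _ hd hv hr =>
          obtain ⟨-, rfl⟩ := h.injective hI hr
          simp only [literalEntry, iriFields_data, List.mem_singleton, Prod.mk.injEq] at hmem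
          obtain ⟨rfl, rfl⟩ := hmem
          exact hv
    · simp at hmem
  · intro hv
    have hA : A ∈ S.att R := by
      by_contra hA
      simp [I.supp R t h.mem_rows A hA] at hv
    refine ⟨(x, dataIRI base A R, Term.lit v), (hl _ _ _).2 (.literal A R t v x
      ⟨h.isClass.1, hA, h.isClass.2⟩ hv h), ?_⟩
    simp [literalEntry]

theorem mem_attCode (hl : ∀ x p y, (x, p, y) ∈ l ↔ DMTriple base ids K I x p y) {R A : Name} :
    (R, A) ∈ (dbCode base l).1 ↔ A ∈ S.att R := by
  simp only [dbCode, List.mem_flatMap]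
  have hrels : A ∈ S.att R → R ∈ S.rels := by
    intro hA
    by_contra hR
    simp [S.att_out R hR] at hA
  constructor
  · rintro ⟨⟨x, p, y⟩, hg, hmem⟩
    rw [hl] at hg
    simp only [attCode] at hmem
    split_ifs at hmem with h1 h2
    · subst h1
      cases hg with
      | data A' R' h =>
        simp only [nodeFields, iriFields_data, List.mem_singleton, Prod.mk.injEq] at hmem
        obtain ⟨rfl, rfl⟩ := hmem
        exact h.2.1
      | binRef _ _ _ _ _ _ _ _ _ _ _ _ _ _ _ _ _ hr => cases hr
      | fkRef _ _ _ _ _ _ _ _ _ _ _ hr => cases hr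
    · obtain ⟨rfl, hlen⟩ := h2
      cases hg with
      | binObj R' A' B T₁ C T₂ D h =>
        simp only [nodeFields, iriFields_bin, List.mem_cons, Prod.mk.injEq, List.not_mem_nil,
          or_false] at hmem
        rcases hmem with ⟨rfl, rfl⟩ | ⟨rfl, rfl⟩ <;> rw [h.mem_att] <;> simp
      | fkObj as bs R' T h =>
        have := h.1.length_eq
        replace hlen : (iriFields base (fkIRI base as bs R' T)).length = 5 := hlen
        rw [iriFields_fk _ _ _ _ _ h.1.ne_nil] at hlen
        simp only [List.length_cons, List.length_append] at hlen
        omega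
      | binRef _ _ _ _ _ _ _ _ _ _ _ _ _ _ _ _ _ hr => cases hr
      | fkRef _ _ _ _ _ _ _ _ _ _ _ hr => cases hr
    · simp at hmem
  · intro hA
    by_cases hb : IsBinRel K R
    · obtain ⟨A', B, T₁, C, T₂, D, hb⟩ := hb
      refine ⟨_, (hl _ _ _).2 (.binObj R A' B T₁ C T₂ D hb), ?_⟩
      have := (hb.mem_att A).1 hA
      simpa [attCode, nodeFields] using this
    · refine ⟨_, (hl _ _ _).2 (.data A R ⟨hrels hA, hA, hb⟩), ?_⟩
      simp [attCode, nodeFields]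

theorem mem_classRowCode (hl : ∀ x p y, (x, p, y) ∈ l ↔ DMTriple base ids K I x p y) {R : Name}
    {row : List (Name × Val)} :
    (∃ g ∈ l, (R, row) ∈ classRowCode base l g) ↔
      ∃ t x, RowId base ids K I R t x ∧ row = nodeRow base l (Term.node x) := by
  constructor
  · rintro ⟨⟨x, p, y⟩, hg, hmem⟩
    simp only [classRowCode] at hmem
    split_ifs at hmem with h
    · obtain ⟨rfl, hlen⟩ := h
      rw [hl] at hg
      generalize hp : IRI.voc .rdfType = p at hg
      cases hg with
      | table R' t _ hr =>
        simp only [termFields, nodeFields, iriFields_class, List.mem_singleton,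
          Prod.mk.injEq] at hmem
        obtain ⟨rfl, rfl⟩ := hmem
        exact ⟨t, x, hr, rfl⟩
      | cls => simp [termFields, nodeFields] at hlen
      | binObj => simp [termFields, nodeFields] at hlen
      | fkObj => simp [termFields, nodeFields] at hlen
      | data => simp [termFields, nodeFields] at hlen
      | _ => cases hp
    · simp at hmem
  · rintro ⟨t, x, h, rfl⟩
    refine ⟨_, (hl _ _ _).2 (.table R t x h), ?_⟩
    simp [classRowCode, termFields, nodeFields]

theorem mem_binRowCode (hI : I.Models K)
    (hl : ∀ x p y, (x, p, y) ∈ l ↔ DMTriple base ids K I x p y) {R : Name}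
    {row : List (Name × Val)} :
    (∃ g ∈ l, (R, row) ∈ binRowCode base l g) ↔
      ∃ A B T₁ C T₂ D t v w, BinRel K R A B T₁ C T₂ D ∧ t ∈ I.rows R ∧ t A = some v ∧
        t B = some w ∧ row = [(A, v), (B, w)] := by
  constructor
  · rintro ⟨⟨x, p, y⟩, hg, hmem⟩
    simp only [binRowCode] at hmem
    split_ifs at hmem with h
    · rw [hl, dmTriple_bin h] at hg
      obtain ⟨R', A, B, T₁, C, T₂, D, t, t₁, t₂, x₂, rfl, hb, ht, hA, hB, h₁, h₂, rfl⟩ := hg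
      simp only [List.mem_flatMap] at hmem
      obtain ⟨⟨C', v⟩, hC, ⟨D', w⟩, hD, hmem⟩ := hmem
      simp only [joinCode, iriFields_bin] at hmem
      rw [mem_nodeRow hI hl h₁] at hC
      rw [mem_nodeRow hI hl h₂] at hD
      split_ifs at hmem with he
      · obtain ⟨rfl, rfl⟩ : C' = C ∧ D' = D := by simpa using he
        obtain ⟨rfl, rfl⟩ : R = R' ∧ row = [(A, v), (B, w)] := by simpa using hmem
        exact ⟨A, B, T₁, C', T₂, D', t, v, w, hb, ht, hA.trans hC, hB.trans hD, rfl⟩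
      · simp at hmem
    · simp at hmem
  · rintro ⟨A, B, T₁, C, T₂, D, t, v, w, hb, ht, hA, hB, rfl⟩
    obtain ⟨t₁, t₂, x₁, x₂, v', w', h₁, h₂, hA', hC, hB', hD⟩ :=
      hb.exists_refs (base := base) (ids := ids) hI ht
    refine ⟨_, (hl _ _ _).2 (.binRef R A B T₁ C T₂ D t t₁ t₂ x₁ x₂ hb ht (hA'.trans hC.symm)
      (hB'.trans hD.symm) h₁ h₂), ?_⟩
    simp only [binRowCode, iriFields_bin, List.length_cons, List.length_nil, if_true,
      List.mem_flatMap]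
    refine ⟨(C, v), (mem_nodeRow hI hl h₁).2 (hC.trans (hA'.symm.trans hA)), (D, w),
      (mem_nodeRow hI hl h₂).2 (hD.trans (hB'.symm.trans hB)), ?_⟩
    simp [joinCode]

theorem dbCode_toDB (hI : I.Models K)
    (hl : ∀ x p y, (x, p, y) ∈ l ↔ DMTriple base ids K I x p y) :
    (dbCode base l).toDB = ⟨S, I⟩ := by
  refine toDB_eq (fun R A => mem_attCode hl) fun R t hR => ?_
  have hrow : ∀ row, (R, row) ∈ (dbCode base l).2 ↔
      (∃ g ∈ l, (R, row) ∈ classRowCode base l g) ∨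
        ∃ g ∈ l, (R, row) ∈ binRowCode base l g := by
    intro row
    simp only [dbCode, List.mem_flatMap, List.mem_append]
    constructor
    · rintro ⟨g, hg, h | h⟩
      exacts [Or.inl ⟨g, hg, h⟩, Or.inr ⟨g, hg, h⟩]
    · rintro (⟨g, hg, h⟩ | ⟨g, hg, h⟩)
      exacts [⟨g, hg, Or.inl h⟩, ⟨g, hg, Or.inr h⟩]
  simp only [hrow, mem_classRowCode hl, mem_binRowCode hI hl]
  have hclass : ∀ t x, RowId base ids K I R t x →
      (fun A => if A ∈ S.att R then (nodeRow base l (Term.node x)).lookup A else none) = t := by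
    intro t x h
    funext A
    split_ifs with hA
    · exact lookup_eq_of_mem_iff fun v => mem_nodeRow hI hl h
    · exact (I.supp R t h.mem_rows A hA).symm
  have hbin : ∀ {A B T₁ C T₂ D t v w}, BinRel K R A B T₁ C T₂ D → t ∈ I.rows R → t A = some v →
      t B = some w →
      (fun E => if E ∈ S.att R then [(A, v), (B, w)].lookup E else none) = t := by
    intro A B T₁ C T₂ D t v w hb ht hA hB
    funext E
    split_ifs with hE
    · rcases (hb.mem_att E).1 hE with rfl | rfl
      · simp [List.lookup, hA]
      · have : (E == A) = false := by simpa using hb.ne.symm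
        simp [List.lookup, this, hB]
    · exact (I.supp R t ht E hE).symm
  constructor
  · intro ht
    by_cases hb : IsBinRel K R
    · obtain ⟨A, B, T₁, C, T₂, D, hb⟩ := hb
      obtain ⟨-, -, -, -, v, w, -, -, hA, -, hB, -⟩ :=
        hb.exists_refs (base := base) (ids := ids) hI ht
      exact ⟨_, Or.inr ⟨A, B, T₁, C, T₂, D, t, v, w, hb, ht, hA, hB, rfl⟩,
        (hbin hb ht hA hB).symm⟩
    · obtain ⟨x, hx⟩ := exists_rowId (base := base) (ids := ids) hI ⟨hR, hb⟩ ht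
      exact ⟨_, Or.inl ⟨t, x, hx, rfl⟩, (hclass t x hx).symm⟩
  · rintro ⟨_, ⟨t', x, h, rfl⟩ | ⟨A, B, T₁, C, T₂, D, t', v, w, hb, ht, hA, hB, rfl⟩, rfl⟩
    · rw [hclass t' x h]
      exact h.mem_rows
    · rw [hbin hb ht hA hB]
      exact ht

end Correctness

theorem informationPreserving_DMpkfk (base : Word) (ids : TupleIds) (a : Word) :
    InformationPreserving (DMpkfk base ids a) := by
  refine ⟨fun G => (dbCode base (canonicalList G.toList)).toDB,
    ⟨fun l => dbCode base (canonicalList l),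
      ((primrec_dbCode base).comp primrec_canonicalList).to_comp, fun l => ?_⟩, fun S K I hI => ?_⟩
  · exact congrArg (fun l => (dbCode base l).toDB) (canonicalList_congr fun g => by simp)
  · refine dbCode_toDB (ids := ids) hI fun x p y => ?_
    rw [mem_canonicalList, Finset.mem_toList, mem_DMpkfk_of_models hI]

end DirMap

theorem theorem4 (base : DirMap.Word) (ids : DirMap.TupleIds) (a : DirMap.Word) :
    DirMap.InformationPreserving (DirMap.DMpkfk base ids a) ∧
    DirMap.QueryPreserving (DirMap.DMpkfk base ids a) ∧
    DirMap.SemanticsPreserving (DirMap.DMpkfk base ids a) ∧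
    ¬ DirMap.Monotone (DirMap.DMpkfk base ids a) :=
  ⟨DirMap.informationPreserving_DMpkfk base ids a, DirMap.queryPreserving_DMpkfk base ids a,
    DirMap.semanticsPreserving_DMpkfk base ids a, DirMap.not_monotone_DMpkfk base ids a⟩
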